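/- Let $K=\mathrm{GF}(2^7)$, let $\mathrm{Tr}$ be the absolute trace map $K\to\mathrm{GF}(2)$, and let a collineation of $\mathrm{PG}(2,2^7)$ be an element of $\mathrm{P\Gamma L}(3,2^7)$, i.e. a map $x\mapsto Ax^{\sigma}$ with $A\in\mathrm{GL}(3,K)$ and $\sigma\in\mathrm{Aut}(K)$. A maximal arc of degree $d$ is a non-empty proper set of points met by every line in $0$ or $d$ points. For $\alpha,\beta\in K$, $\lambda\in K\setminus\{0\}$ with $\mathrm{Tr}(\alpha\beta)=1$, let $F_{\alpha,\beta,\lambda}$ be the conic $\alpha x^2+xy+\beta y^2+\lambda z^2=0$; its nucleus (the point all of whose lines meet the conic in exactly one point) is $F_0=(0,0,1)$. For $\lambda\ne\lambda'$ put $$F_{\alpha,\beta,\lambda}\oplus F_{\alpha',\beta',\lambda'}=F_{\frac{\alpha\lambda+\alpha'\lambda'}{\lambda+\lambda'},\ \frac{\beta\lambda+\beta'\lambda'}{\lambda+\lambda'},\ \lambda+\lambda'}.$$ A set of such conics is closed if any two distinct members have distinct $\lambda$ and their composition $\oplus$ is again one of these conics and belongs to the set. A degree $d$ maximal arc is of Mathon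 type if it is the image under a collineation of the union of $\{F_0\}$ and the $d-1$ conics of a closed set. It is of Denniston type if it is the image under a collineation of the union of $\{F_0\}$ and the conics $F_{\alpha,1,\lambda}$, $\lambda\in H\setminus\{0\}$, where $\mathrm{Tr}(\alpha)=1$ and $H$ is an additive subgroup of $K$ of order $d$. The images of these conics and of $F_0$ are called the conics and the nucleus of the arc. A Singer $8$-arc is either a degree $8$ maximal arc of Mathon type, not of Denniston type, whose stabilizer in $\mathrm{P\Gamma L}(3,2^7)$ has order $14$, or a degree $8$ maximal arc of Denniston type that admits a group of collineations acting sharply transitively on its $7$ conics. Lemma. Let $\mathcal D=\{C_1,C_2,C_3\}$ be (the set of conics of) a degree $4$ maximal arc of Denniston type in $\mathrm{PG}(2,2^7)$ with nucleus $N$. Let $\theta$ be a collineation of $\mathrm{PG}(2,2^7)$ such that $C_2^{\theta}=C_1$ and $C_4:=C_1^{\theta}$ is disjoint from $C_1$, $C_2$ and $C_3$ and has nucleus $N$. Suppose that $\mathcal D^{\theta^2}$ has exactly one conic in common with $\mathcal D$ and exactly one conic in common with $\mathcal D^{\theta}$. Then there is a unique degree $8$ maximal arc $\mathcal K$ of Mathon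 type whose conics include $C_1,C_2,C_3$ and $C_4$. It has nucleus $N$, it is a Singer $8$-arc, and $\theta$ maps the set of its $7$ conics onto itself and permutes these conics in a single $7$-cycle. Consequently the order of $\theta$ is divisible by $7$. -/

import Mathlib

open scoped Pointwise LinearAlgebra.Projectivization

namespace SingerArc

/-- The points `(x, y, z)` of the projective plane `PG(2, K)`. -/
abbrev Point (K : Type*) [Field K] : Type _ := ℙ K (Fin 3 → K)

/-- The point set of the line `[u, v, w]`: all `(a, b, c)` with `a u + b v + c w = 0`. -/
def line {K : Type*} [Field K] (l : Point K) : Set (Point K) :=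
  {p | Projectivization.orthogonal p l}

theorem semilinear_ne_zero {K : Type*} [Field K] (A : GL (Fin 3) K) (σ : K ≃+* K)
    {v : Fin 3 → K} (hv : v ≠ 0) : (A : Matrix (Fin 3) (Fin 3) K).mulVec (σ ∘ v) ≠ 0 := by
  intro h
  apply hv
  have h0 : σ ∘ v = 0 := by
    have := congrArg ((A⁻¹ : GL (Fin 3) K) : Matrix (Fin 3) (Fin 3) K).mulVec h
    rwa [Matrix.mulVec_mulVec, ← Units.val_mul, inv_mul_cancel, Units.val_one,
      Matrix.one_mulVec, Matrix.mulVec_zero] at this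
  funext i
  have := congrFun h0 i
  simpa using this

theorem comp_mulVec {K : Type*} [Field K] (σ : K ≃+* K) (B : Matrix (Fin 3) (Fin 3) K)
    (v : Fin 3 → K) : σ ∘ (B.mulVec v) = (B.map σ).mulVec (σ ∘ v) := by
  funext i
  simp [Matrix.mulVec, dotProduct, map_sum, map_mul]

/-- The collineation group `PΓL(3, K)` of `PG(2, K)`: all permutations of the points of the form
`x ↦ A x ^ σ`, with `A` an invertible matrix and `σ` an automorphism of the field `K`. -/
def PGammaL (K : Type*) [Field K] : Subgroup (Equiv.Perm (Point K)) where
  carrier := {g | ∃ (A : GL (Fin 3) K) (σ : K ≃+* K), ∀ (v : Fin 3 → K) (hv : v ≠ 0),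
    g (Projectivization.mk K v hv) =
      Projectivization.mk K ((A : Matrix (Fin 3) (Fin 3) K).mulVec (σ ∘ v))
        (semilinear_ne_zero A σ hv)}
  one_mem' := by
    refine ⟨1, RingEquiv.refl K, fun v hv => ?_⟩
    simp only [Equiv.Perm.coe_one, id_eq, Units.val_one, Matrix.one_mulVec]
    rfl
  mul_mem' := by
    rintro g g' ⟨A, σ, h⟩ ⟨B, τ, h'⟩
    refine ⟨A * Matrix.GeneralLinearGroup.map (σ : K →+* K) B, τ.trans σ, fun v hv => ?_⟩
    rw [Equiv.Perm.mul_apply, h' v hv, h]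
    congr 1
    rw [comp_mulVec, Matrix.mulVec_mulVec]
    rfl
  inv_mem' := by
    rintro g ⟨A, σ, h⟩
    refine ⟨Matrix.GeneralLinearGroup.map (σ.symm : K →+* K) A⁻¹, σ.symm, fun v hv => ?_⟩
    rw [Equiv.Perm.inv_eq_iff_eq, h]
    congr 1
    rw [comp_mulVec, Matrix.mulVec_mulVec]
    have h1 : ((Matrix.GeneralLinearGroup.map (σ.symm : K →+* K) A⁻¹ : GL (Fin 3) K) :
        Matrix (Fin 3) (Fin 3) K).map σ = ((A⁻¹ : GL (Fin 3) K) : Matrix (Fin 3) (Fin 3) K) := by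
      ext i j
      simp [Matrix.GeneralLinearGroup.map]
    have h2 : (σ ∘ σ.symm ∘ v) = v := by
      funext i
      simp
    rw [h1, h2, ← Units.val_mul, mul_inv_cancel, Units.val_one, Matrix.one_mulVec]

/-- A maximal arc of degree `d`: a non-empty proper set of points that every line meets in `0`
or `d` points. -/
def IsMaximalArc {K : Type*} [Field K] (d : ℕ) (X : Set (Point K)) : Prop :=
  X.Nonempty ∧ X ≠ Set.univ ∧ ∀ l : Point K, X ∩ line l = ∅ ∨ (X ∩ line l).ncard = d

/-- `N` is the nucleus of `C`: every line through `N` meets `C` in exactly one point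
(that is, is a tangent of `C`). -/
def IsNucleus {K : Type*} [Field K] (C : Set (Point K)) (N : Point K) : Prop :=
  ∀ l : Point K, N ∈ line l → ∃! P, P ∈ C ∧ P ∈ line l

/-- The conic `F_{α,β,γ}` with equation `α x² + x y + β y² + γ z² = 0`
(the equation is homogeneous, so any representative of a point may be used, see `mk_mem_conic`). -/
def conic {K : Type*} [Field K] (α β γ : K) : Set (Point K) :=
  {p | α * p.rep 0 ^ 2 + p.rep 0 * p.rep 1 + β * p.rep 1 ^ 2 + γ * p.rep 2 ^ 2 = 0}

theorem mk_mem_conic {K : Type*} [Field K] (α β γ : K) (v : Fin 3 → K) (hv : v ≠ 0) :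
    Projectivization.mk K v hv ∈ conic α β γ ↔
      α * v 0 ^ 2 + v 0 * v 1 + β * v 1 ^ 2 + γ * v 2 ^ 2 = 0 := by
  obtain ⟨a, ha⟩ := Projectivization.exists_smul_eq_mk_rep K v hv
  have h : α * (a • v) 0 ^ 2 + (a • v) 0 * (a • v) 1 + β * (a • v) 1 ^ 2 + γ * (a • v) 2 ^ 2 =
      (a : K) ^ 2 * (α * v 0 ^ 2 + v 0 * v 1 + β * v 1 ^ 2 + γ * v 2 ^ 2) := by
    simp only [Pi.smul_apply, Units.smul_def, smul_eq_mul]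
    ring
  simp only [conic, Set.mem_ofPred_eq]
  rw [← ha, h]
  simp

/-- The point `F₀ = (0, 0, 1)`. -/
def F₀ (K : Type*) [Field K] : Point K :=
  Projectivization.mk K ![0, 0, 1] (fun h => one_ne_zero (congrFun h 2))

/-- The parameters `(α, β, γ)` of a conic `F_{α,β,γ}`. -/
@[ext] structure Param (K : Type*) where
  α : K
  β : K
  γ : K

/-- The conic with the given parameters. -/
def Param.conic {K : Type*} [Field K] (i : Param K) : Set (Point K) :=
  SingerArc.conic i.α i.β i.γ

/-- The condition that `F_{α,β,γ}` belongs to the family `𝓕`: `Tr(α β) = 1` and `γ ≠ 0`. -/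
def Param.InFamily {K : Type*} [Field K] [Algebra (ZMod 2) K] (i : Param K) : Prop :=
  Algebra.trace (ZMod 2) K (i.α * i.β) = 1 ∧ i.γ ≠ 0

/-- The composition `F_{α,β,γ} ⊕ F_{α',β',γ'}`, meaningful for `γ ≠ γ'` in characteristic two. -/
def Param.comp {K : Type*} [Field K] (i j : Param K) : Param K where
  α := (i.α * i.γ + j.α * j.γ) / (i.γ + j.γ)
  β := (i.β * i.γ + j.β * j.γ) / (i.γ + j.γ)
  γ := i.γ + j.γ

/-- A closed set of conics of the family `𝓕`. -/
def IsClosedSet {K : Type*} [Field K] [Algebra (ZMod 2) K] (S : Set (Param K)) : Prop :=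
  (∀ i ∈ S, i.InFamily) ∧ ∀ i ∈ S, ∀ j ∈ S, i ≠ j → i.γ ≠ j.γ ∧ i.comp j ∈ S

/-- The point set of the arc with set of conics `𝒞` and nucleus `N`. -/
def arcPoints {K : Type*} [Field K] (𝒞 : Set (Set (Point K))) (N : Point K) : Set (Point K) :=
  ⋃₀ 𝒞 ∪ {N}

/-- `𝒞` and `N` are the set of conics and the nucleus of a degree `d` maximal arc of Mathon type:
the arc is the image, under a collineation, of the one given by a closed set of `d - 1` conics
of `𝓕` together with their nucleus `F₀`. -/
def IsMathonArc {K : Type*} [Field K] [Algebra (ZMod 2) K] (d : ℕ)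
    (𝒞 : Set (Set (Point K))) (N : Point K) : Prop :=
  IsMaximalArc d (arcPoints 𝒞 N) ∧
    ∃ (S : Set (Param K)) (g : PGammaL K), IsClosedSet S ∧ S.ncard + 1 = d ∧
      𝒞 = (fun i : Param K => g • i.conic) '' S ∧ N = g • F₀ K

/-- `𝒞` and `N` are the set of conics and the nucleus of a degree `d` maximal arc of Denniston
type: the arc is the image, under a collineation, of the one given by the conics `F_{α,1,γ}`,
`γ ∈ H \ {0}`, and their nucleus `F₀`, where `Tr(α) = 1` and `H` is an additive subgroup of `K`
of order `d`. -/
def IsDennistonArc {K : Type*} [Field K] [Algebra (ZMod 2) K] (d : ℕ)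
    (𝒞 : Set (Set (Point K))) (N : Point K) : Prop :=
  IsMaximalArc d (arcPoints 𝒞 N) ∧
    ∃ (α : K) (H : AddSubgroup K) (g : PGammaL K),
      Algebra.trace (ZMod 2) K α = 1 ∧ Nat.card H = d ∧
      𝒞 = (fun γ : K => g • conic α 1 γ) '' {γ | γ ∈ H ∧ γ ≠ 0} ∧ N = g • F₀ K

/-- The full automorphism group of a point set: its stabilizer in `PΓL(3, K)`. -/
def Aut {K : Type*} [Field K] (X : Set (Point K)) : Subgroup (PGammaL K) :=
  MulAction.stabilizer (PGammaL K) X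

/-- The group `G` of collineations acts sharply transitively on the set of conics `𝒞`. -/
def ActsSharplyTransitively {K : Type*} [Field K] (G : Subgroup (PGammaL K))
    (𝒞 : Set (Set (Point K))) : Prop :=
  (∀ g ∈ G, g • 𝒞 = 𝒞) ∧ ∀ C ∈ 𝒞, ∀ C' ∈ 𝒞, ∃! g : PGammaL K, g ∈ G ∧ g • C = C'

/-- `𝒞` and `N` are the set of conics and the nucleus of a Singer `8`-arc: either a degree `8`
maximal arc of proper Mathon type (that is, not of Denniston type) with full automorphism group
of order `14`, or a degree `8` maximal arc of Denniston type admitting a group of collineations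
that acts sharply transitively on its conics. -/
def IsSingerArc {K : Type*} [Field K] [Algebra (ZMod 2) K]
    (𝒞 : Set (Set (Point K))) (N : Point K) : Prop :=
  (IsMathonArc 8 𝒞 N ∧ ¬ IsDennistonArc 8 𝒞 N ∧ Nat.card (Aut (arcPoints 𝒞 N)) = 14) ∨
    (IsDennistonArc 8 𝒞 N ∧ ∃ G : Subgroup (PGammaL K), ActsSharplyTransitively G 𝒞)

end SingerArc

open SingerArc

/-! Multiply the equation of `F_{α,β,γ}` by `γ` and record the conic as the triple `(αγ, βγ, γ)`.
Composition of conics becomes addition in `K³`, and a collineation fixing `F₀` acts on triples by an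
additive map, `conicAct`. Whether a line missing `F₀` meets a conic is decided by the trace of an
Arf invariant; up to a constant of the conic, this trace is additive in the triple. So if the
constants of an additive family of seven conics equal `1` plus an additive function, every line
missing `F₀` is secant to none or to exactly four of them. Such a family is a maximal arc of degree
8 (`IsArcFamily.inter_line`), and it is of Mathon type once an external line has been moved to `z =
0`.

Disjointness of two conics determines the constant of their sum (`tr_add_of_disjoint`). Hence `C₂`,
`C₁` and `C₄ = θ • C₁` generate a family, and closedness makes it the only Mathon arc of degree 8
that contains them. The two intersection hypotheses force `θ` to act on the index space `GF(2)³` by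
`C₂ ↦ C₁ ↦ C₄ ↦ C₂ + ε C₁ + δ C₄`, a companion map with characteristic polynomial `X³ + δX² + εX +
1`. If that polynomial is reducible, the map has order 3 or 4. But `σ⁷ = 1`, so the seventh power of
the action multiplies every `γ` by one constant, whose order divides both 12 and 127. That seventh
power would then be trivial, a contradiction. So the polynomial is irreducible, the map has order 7,
and the conics form a single 7-cycle.

For the Singer property, an automorphism of the arc that fixes a conic is linear and fixes all
seven. If the arc is not of Denniston type, only the identity and one orthogonal transvection
remain, so the group has order `7 · 2`. If it is of Denniston type, a power of `θ` generates a
sharply transitive group of order 7. -/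

namespace SingerArc

/-! ### The field of order `2^7`: squares, trace and automorphisms. -/

section FieldLemmas

theorem sq_eq_sq_iff_of_char_two {K : Type*} [Field K] [CharP K 2] {x y : K} :
    x ^ 2 = y ^ 2 ↔ x = y :=
  CharTwo.sq_injective.eq_iff

theorem exists_sq_eq_of_char_two {K : Type*} [Field K] [CharP K 2] [Finite K] (x : K) : ∃ y, y ^ 2 = x := by
  obtain ⟨y, hy⟩ := FiniteField.isSquare_of_char_two (ringChar.eq K 2) x
  exact ⟨y, by rw [hy, sq]⟩

/-- The multiplicative group has order 127. -/
theorem eq_one_of_pow_eq_one {K : Type*} [Field K] (hK : Nat.card K = 2 ^ 7) {x : K} (h0 : x ≠ 0) {n : ℕ}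
    (hn : Nat.Coprime n 127) (hx : x ^ n = 1) : x = 1 := by
  have : Finite K := Nat.finite_of_card_ne_zero (by rw [hK]; norm_num)
  have := Fintype.ofFinite K
  have h := FiniteField.pow_card_sub_one_eq_one x h0
  rw [← Nat.card_eq_fintype_card, hK] at h
  have := pow_gcd_eq_one.mpr ⟨hx, h⟩
  rwa [show n.gcd (2 ^ 7 - 1) = 1 from hn, pow_one] at this

variable {K : Type*} [Field K] [Algebra (ZMod 2) K]

/-- The absolute trace. -/
noncomputable abbrev tr (x : K) : ZMod 2 := Algebra.trace (ZMod 2) K x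

theorem charP_two_of_algebra (K : Type*) [Field K] [Algebra (ZMod 2) K] : CharP K 2 :=
  charP_of_injective_algebraMap (algebraMap (ZMod 2) K).injective 2

theorem zmod_two_cases (a : ZMod 2) : a = 0 ∨ a = 1 := by revert a; decide

theorem tr_sq [Finite K] (x : K) : tr (x ^ 2) = tr x := by
  have := Algebra.trace_eq_of_algEquiv (FiniteField.frobeniusAlgEquivOfAlgebraic (ZMod 2) K) x
  simpa [FiniteField.coe_frobeniusAlgEquivOfAlgebraic] using this

theorem tr_surjective [Finite K] : Function.Surjective (tr : K → ZMod 2) :=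
  Algebra.trace_surjective (ZMod 2) K

/-- The additive map `t ↦ t ^ 2 + t`. -/
noncomputable def artinSchreier (K : Type*) [Field K] [Algebra (ZMod 2) K] [Finite K] : K →ₗ[ZMod 2] K :=
  (FiniteField.frobeniusAlgEquivOfAlgebraic (ZMod 2) K).toLinearMap + LinearMap.id

theorem artinSchreier_apply [Finite K] (t : K) : artinSchreier K t = t ^ 2 + t := by
  simp [artinSchreier]

/-- Additive Hilbert 90 by counting dimensions: the image of `t² + t` lies in the kernel of the
trace, and both have codimension one, since `t² + t` has kernel `{0, 1}`. -/
theorem exists_sq_add_self_eq [CharP K 2] [Finite K] {c : K} (hc : tr c = 0) :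
    ∃ t, t ^ 2 + t = c := by
  have hle : LinearMap.range (artinSchreier K) ≤ LinearMap.ker (Algebra.trace (ZMod 2) K) := by
    rintro _ ⟨t, rfl⟩
    have h := tr_sq t
    simp only [tr] at h
    rw [LinearMap.mem_ker, artinSchreier_apply, map_add, h, CharTwo.add_self_eq_zero]
  have hker : LinearMap.ker (artinSchreier K) = Submodule.span (ZMod 2) {(1 : K)} := by
    ext t
    rw [LinearMap.mem_ker, artinSchreier_apply, Submodule.mem_span_singleton]
    constructor
    · intro h
      have h1 : t * (t + 1) = 0 := by linear_combination h
      rcases mul_eq_zero.mp h1 with h0 | h0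
      · exact ⟨0, by simp [h0]⟩
      · exact ⟨1, by rw [one_smul]; exact (CharTwo.add_eq_zero.mp h0).symm⟩
    · rintro ⟨a, rfl⟩
      rcases zmod_two_cases a with rfl | rfl
      · simp
      · simp [CharTwo.add_self_eq_zero]
  have h1 := LinearMap.finrank_range_add_finrank_ker (artinSchreier K)
  rw [hker, finrank_span_singleton one_ne_zero] at h1
  have h2 := LinearMap.finrank_range_add_finrank_ker (Algebra.trace (ZMod 2) K)
  rw [LinearMap.range_eq_top.mpr (tr_surjective (K := K)), finrank_top,
    Module.finrank_self] at h2
  have heq := Submodule.eq_of_le_of_finrank_eq hle (by omega)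
  have hmem : c ∈ LinearMap.ker (Algebra.trace (ZMod 2) K) := hc
  rw [← heq] at hmem
  obtain ⟨t, ht⟩ := hmem
  exact ⟨t, by rw [← artinSchreier_apply, ht]⟩

theorem finrank_of_card (hK : Nat.card K = 2 ^ 7) : Module.finrank (ZMod 2) K = 7 := by
  have : Finite K := Nat.finite_of_card_ne_zero (by rw [hK]; norm_num)
  have h := Module.natCard_eq_pow_finrank (K := ZMod 2) (V := K)
  rw [hK, Nat.card_zmod] at h
  exact (Nat.pow_right_injective le_rfl h).symm

/-- A field automorphism as an algebra automorphism over the prime field. -/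
def toZModAlgEquiv (σ : K ≃+* K) : K ≃ₐ[ZMod 2] K :=
  AlgEquiv.ofRingEquiv (f := σ) fun a => by
    rcases zmod_two_cases a with rfl | rfl <;> simp

theorem ringEquiv_pow_seven (hK : Nat.card K = 2 ^ 7) (σ : K ≃+* K) : (σ : RingAut K) ^ 7 = 1 := by
  have : Finite K := Nat.finite_of_card_ne_zero (by rw [hK]; norm_num)
  have h := IsGalois.card_aut_eq_finrank (ZMod 2) K
  rw [finrank_of_card hK] at h
  have h1 : (toZModAlgEquiv σ) ^ 7 = 1 := by rw [← h]; exact pow_card_eq_one'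
  have h2 : ∀ (n : ℕ) (x : K), ((σ : RingAut K) ^ n) x = ((toZModAlgEquiv σ) ^ n) x := by
    intro n
    induction n with
    | zero => intro x; rfl
    | succ n ih => intro x; rw [pow_succ, pow_succ, RingAut.mul_apply, AlgEquiv.mul_apply, ih]; rfl
  ext x
  rw [h2, h1]; rfl

/-- The degree 7 is prime, so the fixed field is either `GF(2)` or all of `K`. -/
theorem ringEquiv_eq_refl_of_fixed (hK : Nat.card K = 2 ^ 7) (σ : K ≃+* K) {x : K}
    (hx : σ x = x) (h0 : x ≠ 0) (h1 : x ≠ 1) : σ = RingEquiv.refl K := by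
  have : Finite K := Nat.finite_of_card_ne_zero (by rw [hK]; norm_num)
  have := Subalgebra.isSimpleOrder_of_finrank_prime (ZMod 2) K
    (by rw [finrank_of_card hK]; norm_num)
  rcases eq_bot_or_eq_top
    (AlgHom.equalizer (toZModAlgEquiv σ : K →ₐ[ZMod 2] K) (AlgHom.id (ZMod 2) K)) with h | h
  · have hm : x ∈ AlgHom.equalizer (toZModAlgEquiv σ : K →ₐ[ZMod 2] K)
      (AlgHom.id (ZMod 2) K) := hx
    rw [h, Algebra.mem_bot] at hm
    obtain ⟨a, rfl⟩ := hm
    rcases zmod_two_cases a with rfl | rfl <;> simp at h0 h1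
  · ext y
    have hm : y ∈ AlgHom.equalizer (toZModAlgEquiv σ : K →ₐ[ZMod 2] K)
      (AlgHom.id (ZMod 2) K) := by rw [h]; trivial
    exact hm

end FieldLemmas

/-- The conic `p x² + γ x y + u y² + γ² z² = 0`, for `h = (p, u, γ)`; in these coordinates the
composition of conics is the addition. -/
def conicOf {K : Type*} [Field K] (h : K × K × K) : Set (Point K) :=
  conic (h.1 / h.2.2) (h.2.1 / h.2.2) h.2.2

theorem mk_mem_conicOf {K : Type*} [Field K] {h : K × K × K} (hγ : h.2.2 ≠ 0) (v : Fin 3 → K)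
    (hv : v ≠ 0) : Projectivization.mk K v hv ∈ conicOf h ↔
      h.1 * v 0 ^ 2 + h.2.2 * v 0 * v 1 + h.2.1 * v 1 ^ 2 + h.2.2 ^ 2 * v 2 ^ 2 = 0 := by
  rw [conicOf, mk_mem_conic]
  have : h.1 * v 0 ^ 2 + h.2.2 * v 0 * v 1 + h.2.1 * v 1 ^ 2 + h.2.2 ^ 2 * v 2 ^ 2 =
    h.2.2 * (h.1 / h.2.2 * v 0 ^ 2 + v 0 * v 1 + h.2.1 / h.2.2 * v 1 ^ 2 + h.2.2 * v 2 ^ 2) := by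
    field_simp
  rw [this, mul_eq_zero, or_iff_right hγ]

theorem mk_mem_line {K : Type*} [Field K] (v w : Fin 3 → K) (hv : v ≠ 0) (hw : w ≠ 0) :
    Projectivization.mk K v hv ∈ line (Projectivization.mk K w hw) ↔
      v 0 * w 0 + v 1 * w 1 + v 2 * w 2 = 0 := by
  rw [line, Set.mem_ofPred_eq, Projectivization.orthogonal_mk, dotProduct, Fin.sum_univ_three]

theorem vec_ne_zero_iff {K : Type*} [Field K] (v : Fin 3 → K) :
    v ≠ 0 ↔ v 0 ≠ 0 ∨ v 1 ≠ 0 ∨ v 2 ≠ 0 := by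
  rw [Ne, funext_iff]
  simp only [Fin.forall_fin_succ, Pi.zero_apply, IsEmpty.forall_iff, and_true]
  rw [not_and_or, not_and_or]; rfl

theorem F₀_mem_line_iff {K : Type*} [Field K] (w : Fin 3 → K) (hw : w ≠ 0) :
    F₀ K ∈ line (Projectivization.mk K w hw) ↔ w 2 = 0 := by
  rw [F₀, mk_mem_line]
  simp

/-! ### Intersections of conics with lines missing `F₀`. -/

section Lines

variable {K : Type*} [Field K]

theorem two_eq_zero_of_char_two [CharP K 2] : (2 : K) = 0 := CharTwo.two_eq_zero

/-- A binary quadratic form with a linear middle term splits when its Arf invariant vanishes. -/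
theorem exists_factorization [CharP K 2] [Algebra (ZMod 2) K] [Finite K] {P U γ : K} (hγ : γ ≠ 0)
    (htr : tr (P * U / γ ^ 2) = 0) :
    ∃ r₁ s₁ r₂ s₂ : K, r₁ * r₂ = P ∧ r₁ * s₂ + r₂ * s₁ = γ ∧ s₁ * s₂ = U := by
  by_cases hP : P = 0
  · exact ⟨0, 1, γ, U, by simp [hP], by simp, by simp⟩
  · obtain ⟨t, ht⟩ := exists_sq_add_self_eq htr
    have h2 : (2 : K) = 0 := two_eq_zero_of_char_two
    -- With `t² + t = PU/γ²`, the form factors as `(P x + γ t y)(x + (γ(t+1)/P) y)`.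
    refine ⟨P, γ * t, 1, γ * (t + 1) / P, by simp, ?_, ?_⟩
    · field_simp
      linear_combination t * h2
    · field_simp at ht ⊢
      linear_combination ht

/-- Converse of `exists_factorization`: for `y ≠ 0` the quotient equals `w² + w` with `w = Px/(γy)`.
-/
theorem tr_eq_zero_of_isotropic [CharP K 2] [Algebra (ZMod 2) K] [Finite K] {P U γ x y : K} (hγ : γ ≠ 0)
    (h : P * x ^ 2 + γ * x * y + U * y ^ 2 = 0) (hxy : x ≠ 0 ∨ y ≠ 0) :
    tr (P * U / γ ^ 2) = 0 := by
  have h2 : (2 : K) = 0 := two_eq_zero_of_char_two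
  by_cases hy : y = 0
  · subst hy
    have hx : x ≠ 0 := by simpa using hxy
    have hP : P = 0 := by simpa [hx] using h
    simp [hP]
  · have h1 : P * U / γ ^ 2 = (P * x / (γ * y)) ^ 2 + P * x / (γ * y) := by
      field_simp
      linear_combination P * h - (P ^ 2 * x ^ 2 + P * x * y * γ) * h2
    have h3 := tr_sq (P * x / (γ * y))
    simp only [tr] at h3 ⊢
    rw [h1, map_add, h3, CharTwo.add_self_eq_zero]

/-- The Arf invariant of the restriction of a conic to the line `z = a x + b y`. -/
noncomputable def lineArf [Algebra (ZMod 2) K] (a b : K) (h : K × K × K) : ZMod 2 :=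
  tr ((h.1 + h.2.2 ^ 2 * a ^ 2) * (h.2.1 + h.2.2 ^ 2 * b ^ 2) / h.2.2 ^ 2)

/-- The additive part of the dependence of `lineArf` on the conic. -/
noncomputable def lineFunctional [Algebra (ZMod 2) K] (a b : K) : K × K × K →+ ZMod 2 where
  toFun h := tr (b ^ 2 * h.1 + a ^ 2 * h.2.1 + a * b * h.2.2)
  map_zero' := by simp
  map_add' h h' := by
    simp only [tr, ← map_add]
    congr 1
    simp only [Prod.fst_add, Prod.snd_add]
    ring

/-- Expanding the product leaves the cross term `(abγ)²`, which has the same trace as `abγ`. The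
line thus enters only through a functional additive in the conic; the whole counting argument rests
on this. -/
theorem lineArf_eq [Algebra (ZMod 2) K] [Finite K] (a b : K) {h : K × K × K} (hγ : h.2.2 ≠ 0) :
    lineArf a b h = tr (h.1 * h.2.1 / h.2.2 ^ 2) + lineFunctional a b h := by
  have h1 : (h.1 + h.2.2 ^ 2 * a ^ 2) * (h.2.1 + h.2.2 ^ 2 * b ^ 2) / h.2.2 ^ 2 =
      h.1 * h.2.1 / h.2.2 ^ 2 + (b ^ 2 * h.1 + a ^ 2 * h.2.1) + (a * b * h.2.2) ^ 2 := by
    field_simp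
    ring
  have h2 := tr_sq (a * b * h.2.2)
  simp only [tr] at h2
  simp only [lineArf, lineFunctional, tr, AddMonoidHom.coe_mk, ZeroHom.coe_mk]
  rw [h1, map_add, map_add, h2, map_add _ _ (a * b * h.2.2), add_assoc]

theorem mem_line_iff [CharP K 2] {w : Fin 3 → K} (hw : w ≠ 0) (hw2 : w 2 ≠ 0) (v : Fin 3 → K) (hv : v ≠ 0) :
    Projectivization.mk K v hv ∈ line (Projectivization.mk K w hw) ↔
      v 2 = w 0 / w 2 * v 0 + w 1 / w 2 * v 1 := by
  rw [mk_mem_line]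
  have h2 : (2 : K) = 0 := two_eq_zero_of_char_two
  constructor
  · intro h
    field_simp
    linear_combination (-1 : K) * h + v 2 * w 2 * h2
  · intro h
    rw [h]
    field_simp
    linear_combination (v 0 * w 0 + v 1 * w 1) * h2

theorem ne_zero_of_mem_line {a b : K} {v : Fin 3 → K} (hv : v ≠ 0)
    (h : v 2 = a * v 0 + b * v 1) : v 0 ≠ 0 ∨ v 1 ≠ 0 := by
  by_contra hc
  push Not at hc
  rw [hc.1, hc.2] at h
  rw [vec_ne_zero_iff] at hv
  simp [hc.1, hc.2, h] at hv

theorem lineArf_eq_zero_of_mem [CharP K 2] [Algebra (ZMod 2) K] [Finite K] {h : K × K × K}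
    (hγ : h.2.2 ≠ 0) {a b : K} {v : Fin 3 → K} (hv : v ≠ 0)
    (hC : Projectivization.mk K v hv ∈ conicOf h) (hl : v 2 = a * v 0 + b * v 1) :
    lineArf a b h = 0 := by
  rw [mk_mem_conicOf hγ, hl] at hC
  refine tr_eq_zero_of_isotropic (x := v 0) (y := v 1) hγ ?_ (ne_zero_of_mem_line hv hl)
  have h2 : (2 : K) = 0 := two_eq_zero_of_char_two
  linear_combination hC - (h.2.2 ^ 2 * a * b * v 0 * v 1) * h2

theorem inter_line_eq_empty [CharP K 2] [Algebra (ZMod 2) K] [Finite K] {h : K × K × K} (hγ : h.2.2 ≠ 0)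
    {w : Fin 3 → K} (hw : w ≠ 0) (hw2 : w 2 ≠ 0)
    (htr : lineArf (w 0 / w 2) (w 1 / w 2) h = 1) :
    conicOf h ∩ line (Projectivization.mk K w hw) = ∅ := by
  rw [Set.eq_empty_iff_forall_notMem]
  intro P
  induction P using Projectivization.ind with
  | h v hv =>
    rintro ⟨hC, hl⟩
    rw [mem_line_iff hw hw2] at hl
    rw [lineArf_eq_zero_of_mem hγ hv hC hl] at htr
    exact zero_ne_one htr

theorem mk_eq_mk_of_line {a b : K} {v v' : Fin 3 → K} (hv : v ≠ 0) (hv' : v' ≠ 0)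
    (h : v 2 = a * v 0 + b * v 1) (h' : v' 2 = a * v' 0 + b * v' 1) :
    Projectivization.mk K v hv = Projectivization.mk K v' hv' ↔ v 0 * v' 1 = v 1 * v' 0 := by
  rw [Projectivization.mk_eq_mk_iff']
  constructor
  · rintro ⟨c, rfl⟩
    simp only [Pi.smul_apply, smul_eq_mul]
    ring
  · intro hx
    rcases ne_zero_of_mem_line hv' h' with h0 | h0
    · refine ⟨v 0 / v' 0, ?_⟩
      ext i
      fin_cases i
      · simp [h0]
      · simp; field_simp; linear_combination hx
      · simp [h, h']; field_simp; linear_combination b * hx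
    · refine ⟨v 1 / v' 1, ?_⟩
      ext i
      fin_cases i
      · simp; field_simp; linear_combination -hx
      · simp [h0]
      · simp [h, h']; field_simp; linear_combination -a * hx

/-- The two points are the zeros of the two linear factors of the restricted form. They differ
because the determinant of the factors is, in characteristic two, the coefficient `γ`. -/
theorem inter_line_eq_pair [CharP K 2] [Algebra (ZMod 2) K] [Finite K] {h : K × K × K} (hγ : h.2.2 ≠ 0)
    {w : Fin 3 → K} (hw : w ≠ 0) (hw2 : w 2 ≠ 0)
    (htr : lineArf (w 0 / w 2) (w 1 / w 2) h = 0) :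
    ∃ A B, A ≠ B ∧ conicOf h ∩ line (Projectivization.mk K w hw) = {A, B} := by
  have h2 : (2 : K) = 0 := two_eq_zero_of_char_two
  obtain ⟨r₁, s₁, r₂, s₂, hP, hg, hU⟩ := exists_factorization hγ htr
  set a := w 0 / w 2 with ha
  set b := w 1 / w 2 with hb
  have hvA : (![s₁, r₁, a * s₁ + b * r₁] : Fin 3 → K) ≠ 0 := by
    rw [vec_ne_zero_iff]
    by_contra hc
    push Not at hc
    simp only [Matrix.cons_val_zero, Matrix.cons_val_one] at hc
    rw [hc.1, hc.2.1] at hg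
    exact hγ (by rw [← hg]; ring)
  have hvB : (![s₂, r₂, a * s₂ + b * r₂] : Fin 3 → K) ≠ 0 := by
    rw [vec_ne_zero_iff]
    by_contra hc
    push Not at hc
    simp only [Matrix.cons_val_zero, Matrix.cons_val_one] at hc
    rw [hc.1, hc.2.1] at hg
    exact hγ (by rw [← hg]; ring)
  refine ⟨Projectivization.mk K _ hvA, Projectivization.mk K _ hvB, ?_, ?_⟩
  · rw [Ne, mk_eq_mk_of_line (a := a) (b := b) hvA hvB (by simp) (by simp)]
    simp only [Matrix.cons_val_zero, Matrix.cons_val_one]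
    intro hc
    exact hγ (by linear_combination -hg - hc + s₁ * r₂ * h2)
  · ext P
    induction P using Projectivization.ind with
    | h v hv =>
      rw [Set.mem_inter_iff, mem_line_iff hw hw2, mk_mem_conicOf hγ, Set.mem_insert_iff,
        Set.mem_singleton_iff, ← ha, ← hb]
      constructor
      · rintro ⟨hC, hl⟩
        rw [mk_eq_mk_of_line hv hvA hl (by simp), mk_eq_mk_of_line hv hvB hl (by simp)]
        simp only [Matrix.cons_val_zero, Matrix.cons_val_one]
        have : (v 0 * r₁ - v 1 * s₁) * (v 0 * r₂ - v 1 * s₂) = 0 := by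
          rw [hl] at hC
          linear_combination hC + v 0 ^ 2 * hP + v 1 ^ 2 * hU - (v 0 * v 1) * hg -
            (h.2.2 ^ 2 * a * b * v 0 * v 1 + h.2.2 * v 0 * v 1) * h2
        rcases mul_eq_zero.mp this with h0 | h0
        · left; linear_combination h0
        · right; linear_combination h0
      · have key : v 2 = a * v 0 + b * v 1 →
            (v 0 * r₁ = v 1 * s₁ ∨ v 0 * r₂ = v 1 * s₂) →
            h.1 * v 0 ^ 2 + h.2.2 * v 0 * v 1 + h.2.1 * v 1 ^ 2 + h.2.2 ^ 2 * v 2 ^ 2 = 0 := by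
          intro hl hor
          have : (v 0 * r₁ - v 1 * s₁) * (v 0 * r₂ - v 1 * s₂) = 0 := by
            rcases hor with h0 | h0 <;> rw [h0] <;> ring
          rw [hl]
          linear_combination this - v 0 ^ 2 * hP - v 1 ^ 2 * hU + (v 0 * v 1) * hg +
            (h.2.2 ^ 2 * a * b * v 0 * v 1 + h.2.2 * v 0 * v 1) * h2
        have onl : ∀ {s r : K} (hs : (![s, r, a * s + b * r] : Fin 3 → K) ≠ 0),
            Projectivization.mk K v hv = Projectivization.mk K _ hs →
            v 2 = a * v 0 + b * v 1 := by
          intro s r hs he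
          rw [Projectivization.mk_eq_mk_iff'] at he
          obtain ⟨c, rfl⟩ := he
          simp
          ring
        rintro (he | he)
        · have hl := onl hvA he
          rw [mk_eq_mk_of_line hv hvA hl (by simp)] at he
          exact ⟨key hl (Or.inl he), hl⟩
        · have hl := onl hvB he
          rw [mk_eq_mk_of_line hv hvB hl (by simp)] at he
          exact ⟨key hl (Or.inr he), hl⟩

end Lines

/-! ### Nuclei, sums of conics and counting points on a union of conics. -/

section Nucleus

variable {K : Type*} [Field K]

/-- A line through `F₀` fixes the ratio `x : y`; the equation then prescribes `z²`, and squaring is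
bijective. -/
theorem existsUnique_mem_tangent [CharP K 2] [Finite K] {h : K × K × K} (hγ : h.2.2 ≠ 0) {w : Fin 3 → K}
    (hw : w ≠ 0) (hw2 : w 2 = 0) :
    ∃! P, P ∈ conicOf h ∧ P ∈ line (Projectivization.mk K w hw) := by
  have h2 : (2 : K) = 0 := two_eq_zero_of_char_two
  obtain ⟨z, hz⟩ := exists_sq_eq_of_char_two
    ((h.1 * w 1 ^ 2 + h.2.2 * w 1 * w 0 + h.2.1 * w 0 ^ 2) / h.2.2 ^ 2)
  rw [eq_div_iff (pow_ne_zero 2 hγ)] at hz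
  have hw01 : w 0 ≠ 0 ∨ w 1 ≠ 0 := by
    rw [vec_ne_zero_iff] at hw
    simpa [hw2] using hw
  have hv : (![w 1, w 0, z] : Fin 3 → K) ≠ 0 := by
    rw [vec_ne_zero_iff]
    rcases hw01 with h0 | h0 <;> simp [h0]
  refine ⟨Projectivization.mk K _ hv, ⟨?_, ?_⟩, ?_⟩
  · rw [mk_mem_conicOf hγ]
    simp only [Matrix.cons_val]
    linear_combination hz + (h.1 * w 1 ^ 2 + h.2.2 * w 1 * w 0 + h.2.1 * w 0 ^ 2) * h2
  · rw [mk_mem_line]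
    simp only [Matrix.cons_val, hw2]
    linear_combination w 0 * w 1 * h2
  · intro P
    induction P using Projectivization.ind with
    | h v hv0 =>
      rintro ⟨hC, hl⟩
      rw [mk_mem_conicOf hγ] at hC
      rw [mk_mem_line, hw2, mul_zero, add_zero] at hl
      have hc : ∃ c, v 0 = c * w 1 ∧ v 1 = c * w 0 := by
        rcases hw01 with h0 | h0
        · refine ⟨v 1 / w 0, ?_, by field_simp⟩
          field_simp
          linear_combination hl - v 1 * w 1 * h2
        · refine ⟨v 0 / w 1, by field_simp, ?_⟩
          field_simp
          linear_combination hl - v 0 * w 0 * h2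
      obtain ⟨c, hc0, hc1⟩ := hc
      have hc2 : v 2 = c * z := by
        rw [← sq_eq_sq_iff_of_char_two]
        apply mul_left_cancel₀ (pow_ne_zero 2 hγ)
        rw [hc0, hc1] at hC
        linear_combination hC - c ^ 2 * hz -
          c ^ 2 * (h.1 * w 1 ^ 2 + h.2.2 * w 1 * w 0 + h.2.1 * w 0 ^ 2) * h2
      rw [Projectivization.mk_eq_mk_iff']
      refine ⟨c, ?_⟩
      ext i
      fin_cases i <;> simp [hc0, hc1, hc2]

theorem isNucleus_F₀ [CharP K 2] [Finite K] {h : K × K × K} (hγ : h.2.2 ≠ 0) :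
    IsNucleus (conicOf h) (F₀ K) := by
  intro l
  induction l using Projectivization.ind with
  | h w hw =>
    intro hl
    rw [F₀_mem_line_iff] at hl
    exact existsUnique_mem_tangent hγ hw hl

theorem F₀_notMem_conicOf {h : K × K × K} (hγ : h.2.2 ≠ 0) : F₀ K ∉ conicOf h := by
  rw [F₀, mk_mem_conicOf hγ]
  simpa using hγ

theorem mk_eq_F₀_iff {v : Fin 3 → K} (hv : v ≠ 0) :
    Projectivization.mk K v hv = F₀ K ↔ v 0 = 0 ∧ v 1 = 0 := by
  rw [F₀, Projectivization.mk_eq_mk_iff']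
  constructor
  · rintro ⟨c, rfl⟩
    simp
  · rintro ⟨h0, h1⟩
    refine ⟨v 2, ?_⟩
    ext i
    fin_cases i <;> simp [h0, h1]

/-- Every point other than `F₀` lies on a line that misses `F₀`. -/
theorem exists_affine_line {v : Fin 3 → K} (h : v 0 ≠ 0 ∨ v 1 ≠ 0) :
    ∃ a b, v 2 = a * v 0 + b * v 1 := by
  rcases h with h0 | h0
  · exact ⟨v 2 / v 0, 0, by field_simp; ring⟩
  · exact ⟨0, v 2 / v 1, by field_simp; ring⟩

theorem affine_line_ne_zero (a b : K) : (![a, b, 1] : Fin 3 → K) ≠ 0 :=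
  fun h => one_ne_zero (congrFun h 2)

/-- Any other point lies on a line missing `F₀`, and such a line meets the conic in 0 or 2 points,
never in one. -/
theorem IsNucleus.eq_F₀ [CharP K 2] [Algebra (ZMod 2) K] [Finite K] {h : K × K × K} (hγ : h.2.2 ≠ 0)
    {N : Point K} (hN : IsNucleus (conicOf h) N) : N = F₀ K := by
  induction N using Projectivization.ind with
  | h v hv =>
    by_contra hne
    rw [mk_eq_F₀_iff] at hne
    obtain ⟨a, b, hab⟩ := exists_affine_line (v := v) (by tauto)
    have hw := affine_line_ne_zero a b
    obtain ⟨P, ⟨hP, hPl⟩, huniq⟩ := hN (Projectivization.mk K _ hw)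
      ((mem_line_iff hw (by simp) v hv).mpr (by simpa using hab))
    have hPm : P ∈ conicOf h ∩ line (Projectivization.mk K _ hw) := ⟨hP, hPl⟩
    rcases zmod_two_cases (lineArf ((![a, b, 1] : Fin 3 → K) 0 / (![a, b, 1] : Fin 3 → K) 2)
      ((![a, b, 1] : Fin 3 → K) 1 / (![a, b, 1] : Fin 3 → K) 2) h) with h0 | h1
    · obtain ⟨A, B, hAB, hl⟩ := inter_line_eq_pair hγ hw (by simp) h0
      have hA : A ∈ conicOf h ∩ line (Projectivization.mk K _ hw) := by rw [hl]; simp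
      have hB : B ∈ conicOf h ∩ line (Projectivization.mk K _ hw) := by rw [hl]; simp
      exact hAB ((huniq A hA).trans (huniq B hB).symm)
    · rw [inter_line_eq_empty hγ hw (by simp) h1] at hPm
      exact hPm

/-- The equations add up, because `γ² + γ'² = (γ + γ')²`. -/
theorem mem_conicOf_add [CharP K 2] {h h' : K × K × K} (hγ : h.2.2 ≠ 0) (hγ' : h'.2.2 ≠ 0)
    (hs : (h + h').2.2 ≠ 0) {P : Point K} (hP : P ∈ conicOf h) (hP' : P ∈ conicOf h') :
    P ∈ conicOf (h + h') := by
  induction P using Projectivization.ind with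
  | h v hv =>
    rw [mk_mem_conicOf (by assumption)] at *
    simp only [Prod.fst_add, Prod.snd_add]
    have h2 : (2 : K) = 0 := two_eq_zero_of_char_two
    linear_combination hP + hP' + h.2.2 * h'.2.2 * v 2 ^ 2 * h2

theorem conicOf_nonempty [CharP K 2] [Finite K] {h : K × K × K} (hγ : h.2.2 ≠ 0) :
    (conicOf h).Nonempty := by
  have hw : (![1, 0, 0] : Fin 3 → K) ≠ 0 := fun h => one_ne_zero (congrFun h 0)
  obtain ⟨P, hP, -⟩ := existsUnique_mem_tangent hγ hw (by simp)
  exact ⟨P, hP.1⟩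

/-- The index group of the conics of a degree `8` arc. -/
abbrev Idx : Type := ZMod 2 × ZMod 2 × ZMod 2

theorem ncard_inter_iUnion [Finite K] {f : Idx → Set (Point K)}
    (hf : ∀ i j, i ≠ 0 → j ≠ 0 → i ≠ j → Disjoint (f i) (f j)) (L : Set (Point K)) :
    (⋃₀ (f '' {i | i ≠ 0}) ∩ L).ncard = ∑ i ∈ Finset.univ.filter (fun i : Idx => i ≠ 0),
      (f i ∩ L).ncard := by
  classical
  have : Finite (Point K) := Quotient.finite _
  have := Fintype.ofFinite (Point K)
  have h1 : ⋃₀ (f '' {i | i ≠ 0}) ∩ L =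
      ((Finset.univ.filter (fun i : Idx => i ≠ 0)).biUnion fun i => (f i ∩ L).toFinset :
        Finset (Point K)) := by
    ext P
    simp only [Set.mem_inter_iff, Set.mem_sUnion, Set.mem_image, Finset.coe_biUnion,
      Set.mem_iUnion, Set.coe_toFinset, Finset.mem_coe, Finset.mem_filter, Finset.mem_univ,
      true_and]
    constructor
    · rintro ⟨⟨_, ⟨i, hi, rfl⟩, hP⟩, hL⟩
      exact ⟨i, hi, hP, hL⟩
    · rintro ⟨i, hi, hP, hL⟩
      exact ⟨⟨_, ⟨i, hi, rfl⟩, hP⟩, hL⟩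
  rw [h1, Set.ncard_coe_finset, Finset.card_biUnion]
  · refine Finset.sum_congr rfl fun i _ => ?_
    rw [Set.ncard_eq_toFinset_card']
  · intro i hi j hj hij
    rw [Function.onFun, Set.disjoint_toFinset]
    simp only [Finset.coe_filter, Finset.mem_univ, true_and, Set.mem_ofPred_eq] at hi hj
    exact (hf i j hi hj hij).mono Set.inter_subset_left Set.inter_subset_left

end Nucleus

/-! ### Additive families of conics form maximal arcs. -/

section ArcFamily

variable {K : Type*} [Field K] [Algebra (ZMod 2) K]

/-- A family of conics, closed under composition, whose Arf invariants relative to the line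
`z = 0` differ from `1` by an additive function. -/
structure IsArcFamily (e : Idx →+ K × K × K) (ψ : Idx →+ ZMod 2) : Prop where
  ne_zero : ∀ i, i ≠ 0 → (e i).2.2 ≠ 0
  tr_eq : ∀ i, i ≠ 0 → tr ((e i).1 * (e i).2.1 / (e i).2.2 ^ 2) = 1 + ψ i

/-- The conics of a family. -/
def conics (e : Idx →+ K × K × K) : Set (Set (Point K)) := (fun i => conicOf (e i)) '' {i | i ≠ 0}

variable {e : Idx →+ K × K × K} {ψ : Idx →+ ZMod 2}

theorem IsArcFamily.lineArf_eq [Finite K] (he : IsArcFamily e ψ) (a b : K) {i : Idx}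
    (hi : i ≠ 0) : lineArf a b (e i) = 1 + (ψ + (lineFunctional a b).comp e) i := by
  rw [SingerArc.lineArf_eq a b (he.ne_zero i hi), he.tr_eq i hi, add_assoc]; rfl

theorem idx_add_ne_zero {i j : Idx} (h : i ≠ j) : i + j ≠ 0 := by
  revert i j; decide

/-- A common point of conics `i` and `j` also lies on conic `i + j`. On a line through it missing
`F₀`, all three Arf invariants vanish, so an additive function would take the value 1 at `i`, `j`
and `i + j`. -/
theorem IsArcFamily.disjoint [CharP K 2] [Finite K] (he : IsArcFamily e ψ) {i j : Idx}
    (hi : i ≠ 0) (hj : j ≠ 0) (hij : i ≠ j) : Disjoint (conicOf (e i)) (conicOf (e j)) := by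
  rw [Set.disjoint_left]
  intro P hP hP'
  have hs := he.ne_zero _ (idx_add_ne_zero hij)
  rw [map_add] at hs
  have hP'' := mem_conicOf_add (he.ne_zero i hi) (he.ne_zero j hj) hs hP hP'
  rw [← map_add] at hP''
  induction P using Projectivization.ind with
  | h v hv =>
    have hv01 : v 0 ≠ 0 ∨ v 1 ≠ 0 := by
      by_contra hc
      push Not at hc
      rw [(mk_eq_F₀_iff hv).mpr hc] at hP
      exact F₀_notMem_conicOf (he.ne_zero i hi) hP
    obtain ⟨a, b, hab⟩ := exists_affine_line hv01
    have h1 := lineArf_eq_zero_of_mem (he.ne_zero _ hi) hv hP hab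
    have h2 := lineArf_eq_zero_of_mem (he.ne_zero _ hj) hv hP' hab
    have h3 := lineArf_eq_zero_of_mem (he.ne_zero _ (idx_add_ne_zero hij)) hv hP'' hab
    rw [he.lineArf_eq a b (by assumption)] at h1 h2
    rw [he.lineArf_eq a b (idx_add_ne_zero hij), map_add] at h3
    generalize (ψ + (lineFunctional a b).comp e) i = x at *
    generalize (ψ + (lineFunctional a b).comp e) j = y at *
    revert x y
    decide

/-- A nonzero functional on `GF(2)³` takes the value 1 on the complement of a plane. -/
theorem card_filter_additive (χ : Idx →+ ZMod 2) (hχ : χ ≠ 0) :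
    (Finset.univ.filter fun i : Idx => i ≠ 0 ∧ χ i = 1).card = 4 := by
  have key : ∀ a b c : ZMod 2, ¬ (a = 0 ∧ b = 0 ∧ c = 0) →
    (Finset.univ.filter fun i : Idx => i ≠ 0 ∧ i.1 * a + i.2.1 * b + i.2.2 * c = 1).card = 4 := by
    decide
  have hval : ∀ i, χ i = i.1 * χ (1, 0, 0) + i.2.1 * χ (0, 1, 0) + i.2.2 * χ (0, 0, 1) := by
    rintro ⟨x, y, z⟩
    have : ((x, y, z) : Idx) = x • (1, 0, 0) + y • (0, 1, 0) + z • (0, 0, 1) := by simp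
    have hl := (χ.toZModLinearMap 2).map_smul
    simp only [AddMonoidHom.coe_toZModLinearMap, smul_eq_mul] at hl
    rw [this, map_add, map_add, hl, hl, hl]
    simp only [← this]
  have h := key (χ (1, 0, 0)) (χ (0, 1, 0)) (χ (0, 0, 1)) (by
    rintro ⟨h1, h2, h3⟩
    exact hχ (AddMonoidHom.ext fun i => by rw [hval i, h1, h2, h3]; simp))
  rw [← h]
  congr 1
  ext i
  simp only [Finset.mem_filter, Finset.mem_univ, true_and]
  rw [hval i]

/-- A line through `F₀` carries `F₀` and one point of each of the seven conics. A line missing `F₀`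
is secant exactly to the conics on which an additive functional equals 1: none, or four with two
points each. -/
theorem IsArcFamily.inter_line [CharP K 2] [Finite K] (he : IsArcFamily e ψ) (l : Point K) :
    arcPoints (conics e) (F₀ K) ∩ line l = ∅ ∨
      (arcPoints (conics e) (F₀ K) ∩ line l).ncard = 8 := by
  have : Finite (Point K) := Quotient.finite _
  have hsum := ncard_inter_iUnion (f := fun i => conicOf (e i))
    (fun i j hi hj hij => he.disjoint hi hj hij) (line l)
  rw [arcPoints, Set.union_inter_distrib_right]
  change (⋃₀ conics e ∩ line l).ncard = _ at hsum
  induction l using Projectivization.ind with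
  | h w hw =>
    by_cases hw2 : w 2 = 0
    · right
      have hF : ({F₀ K} : Set (Point K)) ∩ line (Projectivization.mk K w hw) = {F₀ K} := by
        rw [Set.inter_eq_left, Set.singleton_subset_iff, F₀_mem_line_iff]
        exact hw2
      rw [hF, Set.ncard_union_eq, hsum, Set.ncard_singleton]
      · rw [Finset.sum_congr rfl (g := fun _ => 1)]
        · rfl
        · intro i hi
          obtain ⟨P, hP, hu⟩ := existsUnique_mem_tangent
            (he.ne_zero i (Finset.mem_filter.mp hi).2) hw hw2
          rw [Set.ncard_eq_one]
          exact ⟨P, Set.eq_singleton_iff_unique_mem.mpr ⟨hP, hu⟩⟩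
      · rw [Set.disjoint_singleton_right]
        rintro ⟨⟨_, ⟨i, hi, rfl⟩, hP⟩, -⟩
        exact F₀_notMem_conicOf (he.ne_zero i hi) hP
    · have hF : ({F₀ K} : Set (Point K)) ∩ line (Projectivization.mk K w hw) = ∅ := by
        rw [Set.singleton_inter_eq_empty, F₀_mem_line_iff]
        exact hw2
      rw [hF, Set.union_empty]
      set χ := ψ + (lineFunctional (w 0 / w 2) (w 1 / w 2)).comp e with hχ
      have hcard : ∀ i, i ≠ 0 →
          (conicOf (e i) ∩ line (Projectivization.mk K w hw)).ncard = if χ i = 1 then 2 else 0 := by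
        intro i hi
        have hA := he.lineArf_eq (w 0 / w 2) (w 1 / w 2) hi
        rw [← hχ] at hA
        rcases zmod_two_cases (χ i) with h0 | h0
        · rw [h0, add_zero] at hA
          rw [inter_line_eq_empty (he.ne_zero i hi) hw hw2 hA, h0]
          simp
        · rw [h0] at hA
          obtain ⟨A, B, hAB, hl⟩ := inter_line_eq_pair (he.ne_zero i hi) hw hw2 hA
          rw [hl, h0, Set.ncard_pair hAB]
          simp
      rw [Finset.sum_congr rfl (fun i hi => hcard i (Finset.mem_filter.mp hi).2),
        ← Finset.sum_filter, Finset.filter_filter, Finset.sum_const, smul_eq_mul] at hsum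
      by_cases h0 : χ = 0
      · left
        rw [← Set.ncard_eq_zero, hsum, h0]
        simp
      · right
        rw [hsum, card_filter_additive χ h0]

end ArcFamily

/-! ### Collineations fixing `F₀` and their additive action on conics. -/

section Collineations

variable {K : Type*} [Field K]

/-- `g` is a collineation with accompanying field automorphism `σ`. -/
def HasAut (g : PGammaL K) (σ : K ≃+* K) : Prop :=
  ∃ A : GL (Fin 3) K, ∀ (v : Fin 3 → K) (hv : v ≠ 0), g • Projectivization.mk K v hv =
    Projectivization.mk K ((A : Matrix (Fin 3) (Fin 3) K).mulVec (σ ∘ v)) (semilinear_ne_zero A σ hv)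

theorem exists_hasAut (g : PGammaL K) : ∃ σ, HasAut g σ := by
  obtain ⟨A, σ, h⟩ := g.2
  exact ⟨σ, A, h⟩

theorem HasAut.mul {g g' : PGammaL K} {σ τ : K ≃+* K} (h : HasAut g σ) (h' : HasAut g' τ) :
    HasAut (g * g') (τ.trans σ) := by
  obtain ⟨A, h⟩ := h
  obtain ⟨B, h'⟩ := h'
  refine ⟨A * Matrix.GeneralLinearGroup.map (σ : K →+* K) B, fun v hv => ?_⟩
  rw [mul_smul, h' v hv, h]
  congr 1
  rw [comp_mulVec, Matrix.mulVec_mulVec]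
  rfl

theorem hasAut_one : HasAut (1 : PGammaL K) (RingEquiv.refl K) := by
  refine ⟨1, fun v hv => ?_⟩
  simp only [one_smul, Units.val_one, Matrix.one_mulVec]
  rfl

theorem HasAut.pow {g : PGammaL K} {σ : K ≃+* K} (h : HasAut g σ) (n : ℕ) :
    HasAut (g ^ n) ((σ : RingAut K) ^ n) := by
  induction n with
  | zero => exact hasAut_one
  | succ n ih =>
    rw [pow_succ, pow_succ]
    exact ih.mul h

/-- The collineation `g` fixes `F₀` and its inverse is
`(x, y, z) ↦ σ⁻¹ (M (x, y), a x + b y + z)`. -/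
def IsNormalForm (g : PGammaL K) (σ : K ≃+* K) (M : Matrix (Fin 2) (Fin 2) K) (a b : K) : Prop :=
  ∀ (v w : Fin 3 → K) (hv : v ≠ 0) (hw : w ≠ 0), σ (v 0) = M 0 0 * w 0 + M 0 1 * w 1 →
    σ (v 1) = M 1 0 * w 0 + M 1 1 * w 1 → σ (v 2) = a * w 0 + b * w 1 + w 2 →
    g • Projectivization.mk K v hv = Projectivization.mk K w hw

/-- The inverse matrix is the one to substitute into the equation of a conic to get its image. As
`F₀` is fixed, its last column is a multiple of `(0, 0, 1)`, and the scalar `c` normalizes that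
column. -/
theorem HasAut.exists_isNormalForm {g : PGammaL K} {σ : K ≃+* K} (h : HasAut g σ)
    (hg : g • F₀ K = F₀ K) :
    ∃ M a b, M.det ≠ 0 ∧ IsNormalForm g σ M a b := by
  obtain ⟨A, hA⟩ := h
  rw [F₀, hA, Projectivization.mk_eq_mk_iff'] at hg
  obtain ⟨c, hc⟩ := hg
  set B : Matrix (Fin 3) (Fin 3) K := ((A⁻¹ : GL (Fin 3) K) : Matrix (Fin 3) (Fin 3) K) with hB
  have hAB : (A : Matrix (Fin 3) (Fin 3) K) * B = 1 := by
    rw [hB, ← Units.val_mul, mul_inv_cancel, Units.val_one]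
  have hBA : B * (A : Matrix (Fin 3) (Fin 3) K) = 1 := by
    rw [hB, ← Units.val_mul, inv_mul_cancel, Units.val_one]
  have he : (σ ∘ ![0, 0, 1] : Fin 3 → K) = ![0, 0, 1] := by
    ext i; fin_cases i <;> simp
  rw [he] at hc
  have hBe : ![0, 0, 1] = c • B.mulVec ![0, 0, 1] := by
    have := congrArg B.mulVec hc
    rw [Matrix.mulVec_mulVec, hBA, Matrix.one_mulVec, Matrix.mulVec_smul] at this
    exact this.symm
  have h0 := congrFun hBe 0
  have h1 := congrFun hBe 1
  have h2 := congrFun hBe 2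
  simp only [Matrix.cons_val, Pi.smul_apply, Matrix.mulVec, dotProduct, Fin.sum_univ_three,
    mul_zero, mul_one, zero_add, smul_eq_mul] at h0 h1 h2
  have hc0 : c ≠ 0 := by rintro rfl; simp at h2
  have hB0 : B 0 2 = 0 := by simpa [hc0] using h0
  have hB1 : B 1 2 = 0 := by simpa [hc0] using h1
  have hdet : B.det ≠ 0 := by
    intro h
    have := congrArg Matrix.det hAB
    rw [Matrix.det_mul, h, mul_zero, Matrix.det_one] at this
    exact zero_ne_one this
  rw [Matrix.det_fin_three, hB0, hB1] at hdet
  refine ⟨!![c * B 0 0, c * B 0 1; c * B 1 0, c * B 1 1], c * B 2 0, c * B 2 1, ?_, ?_⟩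
  · rw [Matrix.det_fin_two_of]
    intro hz
    apply hdet
    have : c ^ 2 * (B 0 0 * B 1 1 - B 0 1 * B 1 0) = 0 := by linear_combination hz
    have := (mul_eq_zero.mp this).resolve_left (pow_ne_zero 2 hc0)
    linear_combination B 2 2 * this
  · intro v w hv hw e0 e1 e2
    simp only [Matrix.of_apply, Matrix.cons_val] at e0 e1
    have hσ : σ ∘ v = c • B.mulVec w := by
      ext i
      fin_cases i
      · simp [Matrix.mulVec, dotProduct, Fin.sum_univ_three, e0, hB0]; ring
      · simp [Matrix.mulVec, dotProduct, Fin.sum_univ_three, e1, hB1]; ring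
      · simp only [Fin.reduceFinMk, Function.comp_apply, e2, Pi.smul_apply, Matrix.mulVec,
          dotProduct, Fin.sum_univ_three, smul_eq_mul]
        linear_combination w 2 * h2
    rw [hA, Projectivization.mk_eq_mk_iff']
    refine ⟨c, ?_⟩
    rw [hσ, Matrix.mulVec_smul, Matrix.mulVec_mulVec, hAB, Matrix.one_mulVec]

theorem exists_preimage_vec (σ : K ≃+* K) {M : Matrix (Fin 2) (Fin 2) K} (a b : K)
    (hM : M.det ≠ 0) {w : Fin 3 → K} (hw : w ≠ 0) :
    ∃ v : Fin 3 → K, v ≠ 0 ∧ σ (v 0) = M 0 0 * w 0 + M 0 1 * w 1 ∧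
      σ (v 1) = M 1 0 * w 0 + M 1 1 * w 1 ∧ σ (v 2) = a * w 0 + b * w 1 + w 2 := by
  refine ⟨![σ.symm (M 0 0 * w 0 + M 0 1 * w 1), σ.symm (M 1 0 * w 0 + M 1 1 * w 1),
    σ.symm (a * w 0 + b * w 1 + w 2)], ?_, by simp, by simp, by simp⟩
  intro h
  apply hw
  have h0 := congrFun h 0
  have h1 := congrFun h 1
  have h2 := congrFun h 2
  simp only [Matrix.cons_val, Pi.zero_apply, EmbeddingLike.map_eq_zero_iff] at h0 h1 h2
  rw [Matrix.det_fin_two] at hM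
  have w0 : w 0 = 0 := by
    apply (mul_eq_zero.mp (_ : (M 0 0 * M 1 1 - M 0 1 * M 1 0) * w 0 = 0)).resolve_left hM
    linear_combination M 1 1 * h0 - M 0 1 * h1
  have w1 : w 1 = 0 := by
    apply (mul_eq_zero.mp (_ : (M 0 0 * M 1 1 - M 0 1 * M 1 0) * w 1 = 0)).resolve_left hM
    linear_combination M 0 0 * h1 - M 1 0 * h0
  ext i
  fin_cases i
  · exact w0
  · exact w1
  · simpa [w0, w1] using h2

/-- The action of a collineation fixing `F₀` on the coordinates of the conics. -/
def conicAct [CharP K 2] (σ : K ≃+* K) (M : Matrix (Fin 2) (Fin 2) K) (a b : K) :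
    K × K × K →+ K × K × K where
  -- Substitution gives `xy` the coefficient `σ(γ) det M` and `z²` the coefficient `σ(γ)²`. Division
  -- by `det M ²` restores the shape in which the second is the square of the first. Additivity
  -- holds because `γ` enters otherwise only through its square.
  toFun h :=
    ((σ h.1 * M 0 0 ^ 2 + σ h.2.2 * M 0 0 * M 1 0 + σ h.2.1 * M 1 0 ^ 2 + σ h.2.2 ^ 2 * a ^ 2) /
        M.det ^ 2,
      (σ h.1 * M 0 1 ^ 2 + σ h.2.2 * M 0 1 * M 1 1 + σ h.2.1 * M 1 1 ^ 2 + σ h.2.2 ^ 2 * b ^ 2) /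
        M.det ^ 2,
      σ h.2.2 / M.det)
  map_zero' := by simp
  map_add' h h' := by
    simp only [Prod.fst_add, Prod.snd_add, map_add, CharTwo.add_sq, Prod.mk_add_mk]
    ext <;> simp only <;> ring

theorem IsNormalForm.smul_conicOf [CharP K 2] {g : PGammaL K} {σ : K ≃+* K}
    {M : Matrix (Fin 2) (Fin 2) K} {a b : K} (hg : IsNormalForm g σ M a b) (hM : M.det ≠ 0)
    {h : K × K × K} (hγ : h.2.2 ≠ 0) : g • conicOf h = conicOf (conicAct σ M a b h) := by
  have h2 : (2 : K) = 0 := two_eq_zero_of_char_two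
  have hγ' : (conicAct σ M a b h).2.2 ≠ 0 := div_ne_zero (by simpa using hγ) hM
  ext P
  induction P using Projectivization.ind with
  | h w hw =>
    obtain ⟨v, hv, e0, e1, e2⟩ := exists_preimage_vec σ a b hM hw
    rw [mk_mem_conicOf hγ', ← hg v w hv hw e0 e1 e2, Set.smul_mem_smul_set_iff,
      mk_mem_conicOf hγ, ← σ.map_eq_zero_iff]
    simp only [map_add, map_mul, map_pow, e0, e1, e2]
    simp only [conicAct, AddMonoidHom.coe_mk, ZeroHom.coe_mk]
    rw [← mul_right_inj' (inv_ne_zero (pow_ne_zero 2 hM)), mul_zero]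
    apply Eq.congr_left
    field_simp
    rw [Matrix.det_fin_two]
    linear_combination (σ h.1 * (M 0 0 * M 0 1 * w 0 * w 1) +
      σ h.2.1 * (M 1 0 * M 1 1 * w 0 * w 1) + σ h.2.2 * w 0 * w 1 * M 0 1 * M 1 0 +
      σ h.2.2 ^ 2 * (a * w 0 * w 2 + b * w 1 * w 2 + a * b * w 0 * w 1)) * h2

theorem exists_of_isNormalForm {M : Matrix (Fin 2) (Fin 2) K} (hM : M.det ≠ 0) (a b : K) :
    ∃ g : PGammaL K, IsNormalForm g (RingEquiv.refl K) M a b := by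
  set N : Matrix (Fin 3) (Fin 3) K := !![M 0 0, M 0 1, 0; M 1 0, M 1 1, 0; a, b, 1] with hN
  have hdet : N.det ≠ 0 := by
    rw [Matrix.det_fin_two] at hM
    simpa [hN, Matrix.det_fin_three] using hM
  set A := (Matrix.GeneralLinearGroup.mkOfDetNeZero N hdet)⁻¹ with hA
  have hAN : (A : Matrix (Fin 3) (Fin 3) K) * N = 1 := by
    change (A : Matrix (Fin 3) (Fin 3) K) *
      (Matrix.GeneralLinearGroup.mkOfDetNeZero N hdet : GL (Fin 3) K) = 1
    rw [hA, ← Units.val_mul, inv_mul_cancel, Units.val_one]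
  have hmem : MulAction.toPerm (Matrix.GeneralLinearGroup.toLin A) ∈ PGammaL K :=
    ⟨A, RingEquiv.refl K, fun v hv => rfl⟩
  refine ⟨⟨_, hmem⟩, fun v w hv hw e0 e1 e2 => ?_⟩
  have hv' : v = N.mulVec w := by
    ext i
    fin_cases i
    · simpa [hN, Matrix.mulVec, dotProduct, Fin.sum_univ_three] using e0
    · simpa [hN, Matrix.mulVec, dotProduct, Fin.sum_univ_three] using e1
    · simpa [hN, Matrix.mulVec, dotProduct, Fin.sum_univ_three] using e2
  change Projectivization.mk K ((A : Matrix (Fin 3) (Fin 3) K).mulVec v) _ = _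
  congr 1
  rw [hv', Matrix.mulVec_mulVec, hAN, Matrix.one_mulVec]

theorem IsNormalForm.smul_F₀ {g : PGammaL K} {σ : K ≃+* K} {M : Matrix (Fin 2) (Fin 2) K}
    {a b : K} (hg : IsNormalForm g σ M a b) : g • F₀ K = F₀ K :=
  hg _ _ _ _ (by simp) (by simp) (by simp)

theorem IsNormalForm.eq {g g' : PGammaL K} {σ : K ≃+* K} {M : Matrix (Fin 2) (Fin 2) K}
    {a b : K} (hM : M.det ≠ 0) (hg : IsNormalForm g σ M a b) (hg' : IsNormalForm g' σ M a b) :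
    g = g' := by
  rw [← mul_inv_eq_one]
  apply Subtype.ext
  apply Equiv.ext
  intro P
  change (g * g'⁻¹) • P = P
  induction P using Projectivization.ind with
  | h w hw =>
    obtain ⟨v, hv, e0, e1, e2⟩ := exists_preimage_vec σ a b hM hw
    rw [mul_smul]
    nth_rw 1 [← hg' v w hv hw e0 e1 e2]
    rw [inv_smul_smul, hg v w hv hw e0 e1 e2]

theorem isNormalForm_one : IsNormalForm (1 : PGammaL K) (RingEquiv.refl K) 1 0 0 := by
  intro v w hv hw e0 e1 e2
  rw [one_smul]
  congr 1
  ext i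
  fin_cases i
  · simpa using e0
  · simpa using e1
  · simpa using e2

/-- The linear collineations that fix `F₀` and the line `z = 0` form a group isomorphic to a
quotient of `GL(2, K)`. -/
theorem IsNormalForm.pow {g : PGammaL K} {M : Matrix (Fin 2) (Fin 2) K} (hM : M.det ≠ 0)
    (hg : IsNormalForm g (RingEquiv.refl K) M 0 0) (n : ℕ) :
    IsNormalForm (g ^ n) (RingEquiv.refl K) (M ^ n) 0 0 := by
  induction n with
  | zero => simpa using isNormalForm_one
  | succ n ih =>
    intro v w hv hw e0 e1 e2
    have hM' : (M ^ n).det ≠ 0 := by rw [Matrix.det_pow]; exact pow_ne_zero n hM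
    obtain ⟨u, hu, f0, f1, f2⟩ := exists_preimage_vec (RingEquiv.refl K) 0 0 hM' hw
    rw [pow_succ, mul_smul, hg v u hv hu, ih u w hu hw f0 f1 f2]
    all_goals
      rw [pow_succ'] at e0 e1
      simp only [Matrix.mul_apply, Fin.sum_univ_two, RingEquiv.refl_apply] at *
    · rw [e0, f0, f1]; ring
    · rw [e1, f0, f1]; ring
    · rw [e2, f2]; ring

end Collineations

/-! ### Collineations preserve lines, nuclei and maximal arcs. -/

section Lines

variable {K : Type*} [Field K]

theorem exists_smul_line_eq (g : PGammaL K) (l : Point K) : ∃ l', g • line l' = line l := by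
  obtain ⟨σ, A, hA⟩ := exists_hasAut g
  induction l using Projectivization.ind with
  | h w hw =>
    have hw' : ((σ.symm ∘ ((A : Matrix (Fin 3) (Fin 3) K).vecMul w)) : Fin 3 → K) ≠ 0 := by
      intro h
      apply hw
      have h0 : (A : Matrix (Fin 3) (Fin 3) K).vecMul w = 0 := by
        funext i
        have := congrFun h i
        simpa using this
      have := congrArg ((A⁻¹ : GL (Fin 3) K) : Matrix (Fin 3) (Fin 3) K).vecMul h0
      rwa [Matrix.vecMul_vecMul, ← Units.val_mul, mul_inv_cancel, Units.val_one,
        Matrix.vecMul_one, Matrix.zero_vecMul] at this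
    refine ⟨Projectivization.mk K _ hw', ?_⟩
    ext P
    rw [Set.mem_smul_set_iff_inv_smul_mem]
    obtain ⟨Q, rfl⟩ : ∃ Q, P = g • Q := ⟨g⁻¹ • P, by rw [smul_inv_smul]⟩
    rw [inv_smul_smul]
    induction Q using Projectivization.ind with
    | h v hv =>
      rw [hA, line, line, Set.mem_ofPred_eq, Set.mem_ofPred_eq, Projectivization.orthogonal_mk,
        Projectivization.orthogonal_mk, ← σ.map_eq_zero_iff, dotProduct_comm _ w,
        Matrix.dotProduct_mulVec, dotProduct_comm]
      simp [dotProduct, Fin.sum_univ_three]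

theorem IsNucleus.smul {C : Set (Point K)} {N : Point K} (h : IsNucleus C N) (g : PGammaL K) :
    IsNucleus (g • C) (g • N) := by
  intro l hl
  obtain ⟨l', rfl'⟩ := exists_smul_line_eq g l
  rw [← rfl'] at hl ⊢
  rw [Set.smul_mem_smul_set_iff] at hl
  obtain ⟨P, ⟨hP, hPl⟩, hu⟩ := h l' hl
  refine ⟨g • P, ⟨Set.smul_mem_smul_set hP, Set.smul_mem_smul_set hPl⟩, ?_⟩
  rintro _ ⟨⟨Q, hQ, rfl⟩, hQl⟩
  change g • Q ∈ g • line l' at hQl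
  rw [Set.smul_mem_smul_set_iff] at hQl
  change g • Q = g • P
  rw [hu Q ⟨hQ, hQl⟩]

theorem IsMaximalArc.smul {d : ℕ} {X : Set (Point K)} (h : IsMaximalArc d X) (g : PGammaL K) :
    IsMaximalArc d (g • X) := by
  refine ⟨h.1.smul_set, fun hu => h.2.1 ?_, fun l => ?_⟩
  · rw [smul_eq_iff_eq_inv_smul, Set.smul_set_univ] at hu
    exact hu
  · obtain ⟨l', hl'⟩ := exists_smul_line_eq g l
    rw [← hl', ← Set.smul_set_inter, Set.smul_set_eq_empty, Set.ncard_smul_set]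
    exact h.2.2 l'

theorem arcPoints_smul (g : PGammaL K) (𝒞 : Set (Set (Point K))) (N : Point K) :
    arcPoints (g • 𝒞) (g • N) = g • arcPoints 𝒞 N := by
  rw [arcPoints, arcPoints, Set.smul_set_union, Set.smul_set_singleton]
  congr 1
  ext P
  simp only [Set.mem_sUnion, Set.mem_smul_set]
  constructor
  · rintro ⟨_, ⟨C, hC, rfl⟩, Q, hQ, rfl⟩
    exact ⟨Q, ⟨C, hC, hQ⟩, rfl⟩
  · rintro ⟨Q, ⟨C, hC, hQ⟩, rfl⟩
    exact ⟨_, ⟨C, hC, rfl⟩, Q, hQ, rfl⟩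

end Lines

/-! ### Conics sharing six points coincide. -/

section Bezout

theorem quartic_eq_zero {K : Type*} [Field K] [Finite K] {X : Set K} (hX : 5 ≤ X.ncard) {c₀ c₁ c₂ c₃ c₄ : K}
    (h : ∀ x ∈ X, c₄ * x ^ 4 + c₃ * x ^ 3 + c₂ * x ^ 2 + c₁ * x + c₀ = 0) :
    c₄ = 0 ∧ c₃ = 0 ∧ c₂ = 0 ∧ c₁ = 0 ∧ c₀ = 0 := by
  classical
  have := Fintype.ofFinite K
  set p : Polynomial K := .C c₄ * .X ^ 4 + .C c₃ * .X ^ 3 + .C c₂ * .X ^ 2 + .C c₁ * .X + .C c₀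
    with hp
  have hdeg : p.natDegree ≤ 4 := by rw [hp]; compute_degree
  have hzero : p = 0 := by
    apply Polynomial.eq_zero_of_natDegree_lt_card_of_eval_eq_zero' p X.toFinset
    · intro x hx
      rw [Set.mem_toFinset] at hx
      simpa [hp] using h x hx
    · rw [← Set.ncard_eq_toFinset_card']
      omega
  have hc := fun n => congrArg (fun q => Polynomial.coeff q n) hzero
  have h0 := hc 0
  have h1 := hc 1
  have h2 := hc 2
  have h3 := hc 3
  have h4 := hc 4
  simp [hp, Polynomial.coeff_X, Polynomial.coeff_C] at h0 h1 h2 h3 h4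
  exact ⟨h4, h3, h2, h1, h0⟩

variable {K : Type*} [Field K] [CharP K 2] [Finite K]

/-- A replacement for Bezout. The points of the conic with `y = 1` are parametrized by `x`, with `z`
a square root of a quadratic in `x`. Squaring the second equation eliminates `z` and leaves a
quartic in `x` with at least five roots, as at most one point has `y = 0`. -/
theorem quadratic_form_proportional {h : K × K × K} (hγ : h.2.2 ≠ 0) {a b c f g e : K}
    {T : Set (Point K)} (hT : T ⊆ conicOf h) (hcard : 6 ≤ T.ncard)
    (hQ : ∀ (v : Fin 3 → K) (hv : v ≠ 0), Projectivization.mk K v hv ∈ T →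
      a * v 0 ^ 2 + b * v 1 ^ 2 + c * v 2 ^ 2 + f * v 1 * v 2 + g * v 0 * v 2 + e * v 0 * v 1
        = 0) :
    f = 0 ∧ g = 0 ∧ h.2.2 * a = e * h.1 ∧ h.2.2 * b = e * h.2.1 ∧
      h.2.2 * c = e * h.2.2 ^ 2 := by
  have h2 : (2 : K) = 0 := two_eq_zero_of_char_two
  have : Finite (Point K) := Quotient.finite _
  choose r hr using exists_sq_eq_of_char_two (K := K)
  set z : K → K := fun x => r ((h.1 * x ^ 2 + h.2.2 * x + h.2.1) / h.2.2 ^ 2) with hz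
  have hz2 : ∀ x, h.2.2 ^ 2 * z x ^ 2 = h.1 * x ^ 2 + h.2.2 * x + h.2.1 := by
    intro x
    rw [hz, hr]
    field_simp
  have hne : ∀ x z, (![x, 1, z] : Fin 3 → K) ≠ 0 := fun x z h => one_ne_zero (congrFun h 1)
  have hne' : ∀ z, (![1, 0, z] : Fin 3 → K) ≠ 0 := fun z h => one_ne_zero (congrFun h 0)
  set X : Set K := {x | Projectivization.mk K _ (hne x (z x)) ∈ T} with hX
  have hsub : T ⊆ (fun x => Projectivization.mk K _ (hne x (z x))) '' X ∪
      {Projectivization.mk K _ (hne' (r (h.1 / h.2.2 ^ 2)))} := by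
    intro P hP
    induction P using Projectivization.ind with
    | h v hv =>
      have hC := hT hP
      rw [mk_mem_conicOf hγ] at hC
      by_cases hv1 : v 1 = 0
      · right
        rw [Set.mem_singleton_iff, Projectivization.mk_eq_mk_iff']
        have hv2 : v 0 * r (h.1 / h.2.2 ^ 2) = v 2 := by
          rw [← sq_eq_sq_iff_of_char_two, mul_pow, hr]
          field_simp
          rw [hv1] at hC
          linear_combination hC - h.2.2 ^ 2 * v 2 ^ 2 * h2
        refine ⟨v 0, ?_⟩
        ext i
        fin_cases i <;> simp [hv1, hv2]
      · left
        have hv2 : v 1 * z (v 0 / v 1) = v 2 := by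
          rw [← sq_eq_sq_iff_of_char_two]
          apply mul_left_cancel₀ (pow_ne_zero 2 hγ)
          have := hz2 (v 0 / v 1)
          rw [mul_pow, mul_left_comm, this]
          field_simp
          linear_combination hC - h.2.2 ^ 2 * v 2 ^ 2 * h2
        have heq : Projectivization.mk K v hv =
            Projectivization.mk K _ (hne (v 0 / v 1) (z (v 0 / v 1))) := by
          rw [Projectivization.mk_eq_mk_iff']
          refine ⟨v 1, ?_⟩
          ext i
          fin_cases i
          · simp; field_simp
          · simp
          · simpa using hv2
        rw [heq] at hP
        exact ⟨v 0 / v 1, hP, heq.symm⟩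
  have hX5 : 5 ≤ X.ncard := by
    have h1 := Set.ncard_le_ncard hsub
    have h3 := Set.ncard_union_le ((fun x => Projectivization.mk K _ (hne x (z x))) '' X)
      {Projectivization.mk K _ (hne' (r (h.1 / h.2.2 ^ 2)))}
    have h4 := Set.ncard_image_le (f := fun x => Projectivization.mk K _ (hne x (z x)))
      (Set.toFinite X)
    rw [Set.ncard_singleton] at h3
    omega
  have hquart := quartic_eq_zero hX5
    (c₄ := (h.2.2 ^ 2 * a + c * h.1) ^ 2 + h.2.2 ^ 2 * h.1 * g ^ 2)
    (c₃ := h.2.2 ^ 3 * g ^ 2)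
    (c₂ := (h.2.2 ^ 2 * e + c * h.2.2) ^ 2 + h.2.2 ^ 2 * (h.2.1 * g ^ 2 + h.1 * f ^ 2))
    (c₁ := h.2.2 ^ 3 * f ^ 2)
    (c₀ := (h.2.2 ^ 2 * b + c * h.2.1) ^ 2 + h.2.2 ^ 2 * h.2.1 * f ^ 2) (by
      intro x hx
      have hQx := hQ _ _ hx
      simp only [Matrix.cons_val] at hQx
      have hzx := hz2 x
      set A := h.2.2 ^ 2 * a + c * h.1 with hA
      set E := h.2.2 ^ 2 * e + c * h.2.2 with hE
      set B := h.2.2 ^ 2 * b + c * h.2.1 with hB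
      -- Modulo the conic, the terms containing `z` are isolated on the right; squaring both sides
      -- then replaces `z²` by a polynomial in `x`.
      have h3 : A * x ^ 2 + E * x + B = h.2.2 ^ 2 * z x * (g * x + f) := by
        rw [hA, hE, hB]
        linear_combination h.2.2 ^ 2 * hQx - c * hzx - h.2.2 ^ 2 * z x * (g * x + f) * h2
      have h4 : (A * x ^ 2 + E * x + B) ^ 2 = A ^ 2 * x ^ 4 + E ^ 2 * x ^ 2 + B ^ 2 := by
        rw [CharTwo.add_sq, CharTwo.add_sq]; ring
      rw [h3] at h4
      have h5 : (g * x + f) ^ 2 = g ^ 2 * x ^ 2 + f ^ 2 := by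
        rw [CharTwo.add_sq]; ring
      linear_combination -h4 + (h.2.2 ^ 2 * (h.1 * x ^ 2 + h.2.2 * x + h.2.1)) * h5 +
        h.2.2 ^ 2 * (g * x + f) ^ 2 * hzx +
        (h.2.2 ^ 2 * (h.1 * x ^ 2 + h.2.2 * x + h.2.1) * (g ^ 2 * x ^ 2 + f ^ 2)) * h2)
  obtain ⟨k4, k3, k2, k1, k0⟩ := hquart
  have hg : g = 0 := by simpa [hγ] using k3
  have hf : f = 0 := by simpa [hγ] using k1
  simp only [hg, hf, ne_eq, OfNat.ofNat_ne_zero, not_false_eq_true, zero_pow, mul_zero, add_zero,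
    pow_eq_zero_iff] at k4 k2 k0
  have hγ2 := pow_ne_zero 2 hγ
  have hc : c = h.2.2 * e := by
    apply mul_left_cancel₀ hγ
    linear_combination k2 - h.2.2 ^ 2 * e * h2
  subst hc
  refine ⟨hf, hg, ?_, ?_, by ring⟩
  · apply mul_left_cancel₀ hγ
    linear_combination k4 - h.2.2 * e * h.1 * h2
  · apply mul_left_cancel₀ hγ
    linear_combination k0 - h.2.2 * e * h.2.1 * h2

theorem card_le_ncard_conicOf {h : K × K × K} (hγ : h.2.2 ≠ 0) :
    Nat.card K ≤ (conicOf h).ncard := by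
  have : Finite (Point K) := Quotient.finite _
  have h2 : (2 : K) = 0 := two_eq_zero_of_char_two
  choose r hr using exists_sq_eq_of_char_two (K := K)
  set z : K → K := fun x => r ((h.1 * x ^ 2 + h.2.2 * x + h.2.1) / h.2.2 ^ 2) with hz
  have hne : ∀ x z, (![x, 1, z] : Fin 3 → K) ≠ 0 := fun x z h => one_ne_zero (congrFun h 1)
  have hinj : Function.Injective fun x => Projectivization.mk K _ (hne x (z x)) := by
    intro x y hxy
    rw [Projectivization.mk_eq_mk_iff'] at hxy
    obtain ⟨c, hc⟩ := hxy
    have h0 := congrFun hc 0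
    have h1 := congrFun hc 1
    simp at h0 h1
    rw [← h0, h1, one_mul]
  rw [← Set.ncard_univ, ← Set.ncard_image_of_injective _ hinj]
  refine Set.ncard_le_ncard ?_ (Set.toFinite _)
  rintro _ ⟨x, -, rfl⟩
  rw [mk_mem_conicOf hγ]
  simp only [Matrix.cons_val, hz, hr]
  field_simp
  linear_combination (h.1 * x ^ 2 + h.2.2 * x + h.2.1) * h2

/-- Equal conics have proportional forms, and the coefficient of `z²` being the square of that of
`xy` forces the factor to be 1. -/
theorem conicOf_injective (hK : 6 ≤ Nat.card K) {h h' : K × K × K} (hγ : h.2.2 ≠ 0)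
    (hγ' : h'.2.2 ≠ 0) (heq : conicOf h = conicOf h') : h = h' := by
  have := quadratic_form_proportional hγ (a := h'.1) (b := h'.2.1) (c := h'.2.2 ^ 2) (f := 0)
    (g := 0) (e := h'.2.2) (Set.Subset.refl _) (hK.trans (card_le_ncard_conicOf hγ)) (by
      intro v hv hm
      rw [heq, mk_mem_conicOf hγ'] at hm
      linear_combination hm)
  obtain ⟨-, -, h1, h2, h3⟩ := this
  have hg : h.2.2 = h'.2.2 := by
    apply mul_left_cancel₀ (mul_ne_zero hγ hγ')
    linear_combination -h3
  rw [hg] at h1 h2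
  ext
  · exact (mul_left_cancel₀ hγ' h1).symm
  · exact (mul_left_cancel₀ hγ' h2).symm
  · exact hg

/-- The image of a conic under a collineation is the zero set of a quadratic form. -/
theorem smul_conicOf_eq_of_ncard (g : PGammaL K) {h h' : K × K × K} (hγ : h.2.2 ≠ 0)
    (hγ' : h'.2.2 ≠ 0) (hcard : 6 ≤ (g • conicOf h ∩ conicOf h').ncard) :
    g • conicOf h = conicOf h' := by
  obtain ⟨σ, A, hA⟩ := exists_hasAut g
  set B : Matrix (Fin 3) (Fin 3) K := ((A⁻¹ : GL (Fin 3) K) : Matrix (Fin 3) (Fin 3) K) with hB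
  have hAB : (A : Matrix (Fin 3) (Fin 3) K) * B = 1 := by
    rw [hB, ← Units.val_mul, mul_inv_cancel, Units.val_one]
  have hBA : B * (A : Matrix (Fin 3) (Fin 3) K) = 1 := by
    rw [hB, ← Units.val_mul, inv_mul_cancel, Units.val_one]
  set p := σ h.1
  set u := σ h.2.1
  set γ := σ h.2.2
  have hγσ : γ ≠ 0 := by simpa [γ] using hγ
  set Q : (Fin 3 → K) → K := fun x => p * x 0 ^ 2 + γ * x 0 * x 1 + u * x 1 ^ 2 + γ ^ 2 * x 2 ^ 2
    with hQ
  have hmem : ∀ (w : Fin 3 → K) (hw : w ≠ 0), Projectivization.mk K w hw ∈ g • conicOf h ↔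
      Q (B.mulVec w) = 0 := by
    intro w hw
    have hv : (σ.symm ∘ B.mulVec w : Fin 3 → K) ≠ 0 := by
      intro hv
      apply hw
      have h0 : B.mulVec w = 0 := by
        funext i
        have := congrFun hv i
        simpa using this
      have := congrArg (A : Matrix (Fin 3) (Fin 3) K).mulVec h0
      rwa [Matrix.mulVec_mulVec, hAB, Matrix.one_mulVec, Matrix.mulVec_zero] at this
    have hσv : (σ ∘ σ.symm ∘ B.mulVec w : Fin 3 → K) = B.mulVec w := by
      funext i; simp
    have hgv : g • Projectivization.mk K _ hv = Projectivization.mk K w hw := by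
      rw [hA]
      congr 1
      rw [hσv, Matrix.mulVec_mulVec, hAB, Matrix.one_mulVec]
    rw [← hgv, Set.smul_mem_smul_set_iff, mk_mem_conicOf hγ, ← σ.map_eq_zero_iff]
    simp [hQ, p, u, γ]
  obtain ⟨a, b, c, f, e', e, hform⟩ : ∃ a b c f e' e : K, ∀ w : Fin 3 → K, Q (B.mulVec w) =
      a * w 0 ^ 2 + b * w 1 ^ 2 + c * w 2 ^ 2 + f * w 1 * w 2 + e' * w 0 * w 2 + e * w 0 * w 1 := by
    refine ⟨p * B 0 0 ^ 2 + γ * B 0 0 * B 1 0 + u * B 1 0 ^ 2 + γ ^ 2 * B 2 0 ^ 2,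
      p * B 0 1 ^ 2 + γ * B 0 1 * B 1 1 + u * B 1 1 ^ 2 + γ ^ 2 * B 2 1 ^ 2,
      p * B 0 2 ^ 2 + γ * B 0 2 * B 1 2 + u * B 1 2 ^ 2 + γ ^ 2 * B 2 2 ^ 2,
      γ * (B 0 1 * B 1 2 + B 0 2 * B 1 1), γ * (B 0 0 * B 1 2 + B 0 2 * B 1 0),
      γ * (B 0 0 * B 1 1 + B 0 1 * B 1 0), fun w => ?_⟩
    simp only [hQ, Matrix.mulVec, dotProduct, Fin.sum_univ_three, CharTwo.add_sq]
    ring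
  obtain ⟨hf, hg, h1, h2, h3⟩ := quadratic_form_proportional hγ' (a := a) (b := b) (c := c)
    (f := f) (g := e') (e := e) (T := g • conicOf h ∩ conicOf h') Set.inter_subset_right hcard (by
      intro v hv hm
      rw [← hform v, ← hmem v hv]
      exact hm.1)
  have key : ∀ w, h'.2.2 * Q (B.mulVec w) = e * (h'.1 * w 0 ^ 2 + h'.2.2 * w 0 * w 1 +
      h'.2.1 * w 1 ^ 2 + h'.2.2 ^ 2 * w 2 ^ 2) := by
    intro w
    rw [hform w, hf, hg]
    linear_combination w 0 ^ 2 * h1 + w 1 ^ 2 * h2 + w 2 ^ 2 * h3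
  -- Otherwise `Q` would vanish identically, whereas its value at `(0, 0, 1)` is `γ²`.
  have he : e ≠ 0 := by
    rintro rfl
    have := key ((A : Matrix (Fin 3) (Fin 3) K).mulVec ![0, 0, 1])
    rw [Matrix.mulVec_mulVec, hBA, Matrix.one_mulVec, zero_mul] at this
    simp [hQ, hγ', hγσ] at this
  ext P
  induction P using Projectivization.ind with
  | h w hw =>
    rw [hmem w hw, mk_mem_conicOf hγ', ← mul_right_inj' hγ', key w, mul_zero, mul_eq_zero,
      or_iff_right he]

end Bezout

/-! ### Families of conics and Mathon arcs of degree 8. -/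

section Mathon

variable {K : Type*} [Field K]

/-- The parameters of `conicOf h`. -/
def toParam (h : K × K × K) : Param K := ⟨h.1 / h.2.2, h.2.1 / h.2.2, h.2.2⟩

/-- The coordinates of a conic with given parameters. -/
def ofParam (i : Param K) : K × K × K := (i.α * i.γ, i.β * i.γ, i.γ)

theorem conic_toParam (h : K × K × K) : (toParam h).conic = conicOf h := rfl

theorem conicOf_ofParam {i : Param K} (hi : i.γ ≠ 0) : conicOf (ofParam i) = i.conic := by
  simp [conicOf, ofParam, Param.conic, hi]

theorem toParam_comp {h h' : K × K × K} (hγ : h.2.2 ≠ 0) (hγ' : h'.2.2 ≠ 0) :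
    (toParam h).comp (toParam h') = toParam (h + h') := by
  simp [toParam, Param.comp, hγ, hγ']

theorem ofParam_comp {i j : Param K} (h : i.γ + j.γ ≠ 0) :
    ofParam (i.comp j) = ofParam i + ofParam j := by
  simp [ofParam, Param.comp, h]

variable [Algebra (ZMod 2) K] {e : Idx →+ K × K × K} {ψ : Idx →+ ZMod 2}

theorem IsArcFamily.γ_injective (he : IsArcFamily e ψ) {i j : Idx}
    (h : (e i).2.2 = (e j).2.2) : i = j := by
  by_contra hij
  have hs := he.ne_zero _ (sub_ne_zero.mpr hij)
  rw [map_sub, Prod.snd_sub, Prod.snd_sub, h, sub_self] at hs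
  exact hs rfl

/-- A left inverse of `c` turns `ω` into a functional on `K`, and every such functional is a trace
against some `d`. -/
theorem exists_tr_mul_eq [Finite K] (c : Idx →+ K) (hc : Function.Injective c)
    (ω : Idx →+ ZMod 2) : ∃ d : K, ∀ i, tr (d * c i) = ω i := by
  obtain ⟨g, hg⟩ := (c.toZModLinearMap 2).exists_leftInverse_of_injective
    (LinearMap.ker_eq_bot.mpr hc)
  set f : Module.Dual (ZMod 2) K := (ω.toZModLinearMap 2).comp g with hf
  refine ⟨((Algebra.traceForm (ZMod 2) K).toDual (traceForm_nondegenerate (ZMod 2) K)).symm f,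
    fun i => ?_⟩
  have h1 := LinearMap.BilinForm.apply_toDual_symm_apply
    (B := Algebra.traceForm (ZMod 2) K) (hB := traceForm_nondegenerate (ZMod 2) K) f (c i)
  rw [Algebra.traceForm_apply] at h1
  rw [tr, h1, hf, LinearMap.comp_apply]
  have h2 := LinearMap.congr_fun hg i
  simp only [LinearMap.comp_apply, AddMonoidHom.coe_toZModLinearMap, LinearMap.id_apply] at h2
  rw [h2]
  rfl

theorem ncard_idx_ne_zero : {i : Idx | i ≠ 0}.ncard = 7 := by
  rw [Set.ncard_eq_toFinset_card']
  decide

/-- Every family of conics has an external line. -/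
theorem exists_external_line [CharP K 2] [Finite K] (hK : 8 ≤ Nat.card K)
    (he : IsArcFamily e ψ) : ∃ a b, ψ + (lineFunctional a b).comp e = 0 := by
  choose r hr using exists_sq_eq_of_char_two (K := K)
  -- Only seven values of `a` are forbidden, those making `p + γ² a²` vanish on one of the conics.
  -- For any other `a` this quantity is an injective additive function of the index.
  obtain ⟨a, ha⟩ : ∃ a, a ∉ (fun i => r ((e i).1 / (e i).2.2 ^ 2)) '' {i | i ≠ 0} := by
    by_contra hc
    push Not at hc
    have h1 := Set.ncard_image_le (f := fun i => r ((e i).1 / (e i).2.2 ^ 2))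
      (Set.toFinite {i : Idx | i ≠ 0})
    rw [Set.eq_univ_of_forall hc, Set.ncard_univ, ncard_idx_ne_zero] at h1
    omega
  set c : Idx →+ K :=
    (AddMonoidHom.fst K (K × K)).comp ((conicAct (RingEquiv.refl K) 1 a 0).comp e) with hcdef
  have hc : ∀ i, c i = (e i).1 + (e i).2.2 ^ 2 * a ^ 2 := by
    intro i
    simp [hcdef, conicAct]
  have hcinj : Function.Injective c := by
    rw [injective_iff_map_eq_zero]
    intro i hi
    by_contra hne
    apply ha
    refine ⟨i, hne, ?_⟩
    have hγ := he.ne_zero i hne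
    change r ((e i).1 / (e i).2.2 ^ 2) = a
    rw [hc, CharTwo.add_eq_zero] at hi
    rw [← sq_eq_sq_iff_of_char_two, hr, hi]
    field_simp
  -- Since `tr(abγ) = tr(a²b²γ²)`, the part of the condition involving `b` is `tr(b² (p + γ² a²))`,
  -- so `d` plays the role of `b²`.
  obtain ⟨d, hd⟩ := exists_tr_mul_eq c hcinj (ψ + (lineFunctional a 0).comp e)
  refine ⟨a, r d, ?_⟩
  ext1 i
  have hdi := hd i
  have h1 := tr_sq (a * r d * (e i).2.2)
  rw [hc] at hdi
  simp only [tr, lineFunctional, AddMonoidHom.add_apply, AddMonoidHom.comp_apply,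
    AddMonoidHom.coe_mk, ZeroHom.coe_mk, hr, AddMonoidHom.zero_apply] at hdi h1 ⊢
  have h3 : d * ((e i).1 + (e i).2.2 ^ 2 * a ^ 2) = d * (e i).1 + (a * r d * (e i).2.2) ^ 2 := by
    rw [mul_pow, mul_pow, hr]; ring
  have h4 : (0 : K) ^ 2 * (e i).1 + a ^ 2 * (e i).2.1 + a * 0 * (e i).2.2 =
    a ^ 2 * (e i).2.1 := by ring
  rw [h3, h4, map_add, h1] at hdi
  rw [map_add, map_add]
  have h5 := CharTwo.add_self_eq_zero (ψ i + Algebra.trace (ZMod 2) K (a ^ 2 * (e i).2.1))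
  nth_rw 1 [← hdi] at h5
  rw [← h5]
  ring

theorem conics_comp [CharP K 2] {g : PGammaL K} {σ : K ≃+* K} {M : Matrix (Fin 2) (Fin 2) K}
    {a b : K} (hg : IsNormalForm g σ M a b) (hM : M.det ≠ 0) (he : IsArcFamily e ψ) :
    conics ((conicAct σ M a b).comp e) = g • conics e := by
  rw [conics, conics, ← Set.image_smul, Set.image_image]
  refine Set.image_congr fun i hi => ?_
  rw [AddMonoidHom.comp_apply, hg.smul_conicOf hM (he.ne_zero i hi)]

theorem IsArcFamily.isMaximalArc [CharP K 2] [Finite K] (hK : 8 ≤ Nat.card K)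
    (he : IsArcFamily e ψ) : IsMaximalArc 8 (arcPoints (conics e) (F₀ K)) := by
  refine ⟨⟨F₀ K, Or.inr rfl⟩, fun hu => ?_, he.inter_line⟩
  obtain ⟨a, b, hab⟩ := exists_external_line hK he
  have hv : (![1, 0, a] : Fin 3 → K) ≠ 0 := fun h => one_ne_zero (congrFun h 0)
  have hP : Projectivization.mk K _ hv ∈ arcPoints (conics e) (F₀ K) := by rw [hu]; trivial
  rcases hP with ⟨_, ⟨i, hi, rfl⟩, hP⟩ | hP
  · have h0 := lineArf_eq_zero_of_mem (he.ne_zero i hi) hv hP (a := a) (b := b) (by simp)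
    rw [he.lineArf_eq a b hi, hab] at h0
    simp at h0
  · rw [Set.mem_singleton_iff, mk_eq_F₀_iff] at hP
    simp at hP

theorem IsMathonArc.smul {d : ℕ} {𝒞 : Set (Set (Point K))} {N : Point K}
    (h : IsMathonArc d 𝒞 N) (g : PGammaL K) : IsMathonArc d (g • 𝒞) (g • N) := by
  obtain ⟨hm, S, g', hS, hc, rfl, rfl⟩ := h
  refine ⟨by rw [arcPoints_smul]; exact hm.smul g, S, g * g', hS, hc, ?_, by rw [mul_smul]⟩
  rw [← Set.image_smul, Set.image_image]
  simp only [mul_smul]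

/-- Families of conics give maximal arcs of Mathon type. -/
theorem IsArcFamily.isMathonArc [CharP K 2] [Finite K] (hK : 8 ≤ Nat.card K)
    (he : IsArcFamily e ψ) : IsMathonArc 8 (conics e) (F₀ K) := by
  refine ⟨he.isMaximalArc hK, ?_⟩
  obtain ⟨a, b, hab⟩ := exists_external_line hK he
  have h1 : (1 : Matrix (Fin 2) (Fin 2) K).det ≠ 0 := by simp
  -- The elation `g` moves the external line `z = ax + by` to `z = 0`; afterwards every conic has
  -- trace 1, as membership in the standard family demands.
  obtain ⟨g, hg⟩ := exists_of_isNormalForm h1 a b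
  set e' := (conicAct (RingEquiv.refl K) 1 a b).comp e with he'
  have hval : ∀ i, e' i = ((e i).1 + (e i).2.2 ^ 2 * a ^ 2,
      (e i).2.1 + (e i).2.2 ^ 2 * b ^ 2, (e i).2.2) := by
    intro i
    simp [he', conicAct]
  have hfam : IsArcFamily e' 0 := by
    refine ⟨fun i hi => by rw [hval]; exact he.ne_zero i hi, fun i hi => ?_⟩
    rw [hval]
    change lineArf a b (e i) = _
    rw [he.lineArf_eq a b hi, hab]
  refine ⟨(fun i => toParam (e' i)) '' {i | i ≠ 0}, g⁻¹, ⟨?_, ?_⟩, ?_, ?_, ?_⟩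
  · rintro _ ⟨i, hi, rfl⟩
    refine ⟨?_, hfam.ne_zero i hi⟩
    have := hfam.tr_eq i hi
    simp only [AddMonoidHom.zero_apply, add_zero] at this
    rw [← this]
    simp only [tr, toParam]
    congr 1
    field_simp
  · rintro _ ⟨i, hi, rfl⟩ _ ⟨j, hj, rfl⟩ hij
    have hne : i ≠ j := by rintro rfl; exact hij rfl
    refine ⟨fun h => hne (hfam.γ_injective h), i + j, idx_add_ne_zero hne, ?_⟩
    change toParam (e' (i + j)) = (toParam (e' i)).comp (toParam (e' j))
    rw [map_add, toParam_comp (hfam.ne_zero i hi) (hfam.ne_zero j hj)]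
  · rw [Set.ncard_image_of_injective, ncard_idx_ne_zero]
    intro i j hij
    exact hfam.γ_injective (congrArg Param.γ hij)
  · rw [Set.image_image]
    simp only [conic_toParam]
    have h2 := conics_comp hg h1 he
    rw [← he'] at h2
    rw [← inv_smul_eq_iff.mpr h2, conics, ← Set.image_smul, Set.image_image]
  · rw [eq_inv_smul_iff, hg.smul_F₀]

/-- A Mathon arc of degree `8` with nucleus `F₀` containing generators of a family is the arc of
the family. -/
theorem IsArcFamily.eq_of_isMathonArc [CharP K 2] [Finite K] (hK : 8 ≤ Nat.card K)
    (he : IsArcFamily e ψ) {𝒞 : Set (Set (Point K))} {N : Point K} (h : IsMathonArc 8 𝒞 N)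
    (h₁ : conicOf (e (1, 0, 0)) ∈ 𝒞) (h₂ : conicOf (e (0, 1, 0)) ∈ 𝒞)
    (h₃ : conicOf (e (0, 0, 1)) ∈ 𝒞) : 𝒞 = conics e ∧ N = F₀ K := by
  obtain ⟨-, S, g, ⟨hS, hcl⟩, hcard, rfl, rfl⟩ := h
  have hne1 := he.ne_zero (1, 0, 0) (by decide)
  have hN : g • F₀ K = F₀ K := by
    obtain ⟨i, hi, hC⟩ := h₁
    have hnuc := (isNucleus_F₀ (h := ofParam i) (hS i hi).2).smul g
    rw [conicOf_ofParam (hS i hi).2] at hnuc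
    change g • i.conic = _ at hC
    rw [hC] at hnuc
    exact hnuc.eq_F₀ hne1
  refine ⟨?_, hN⟩
  obtain ⟨σ, hσ⟩ := exists_hasAut g
  obtain ⟨M, a, b, hM, hg⟩ := hσ.exists_isNormalForm hN
  set φ := conicAct σ M a b with hφ
  have hγ : ∀ i ∈ S, (φ (ofParam i)).2.2 ≠ 0 := fun i hi =>
    div_ne_zero (by simpa [ofParam] using (hS i hi).2) hM
  have hconic : ∀ i ∈ S, g • i.conic = conicOf (φ (ofParam i)) := by
    intro i hi
    rw [← conicOf_ofParam (hS i hi).2, hg.smul_conicOf hM (hS i hi).2]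
  set T := (fun i => φ (ofParam i)) '' S with hT
  have hmem : ∀ i, i ≠ 0 → conicOf (e i) ∈ (fun i : Param K => g • i.conic) '' S → e i ∈ T := by
    rintro i hi ⟨s, hs, hC⟩
    refine ⟨s, hs, ?_⟩
    change g • s.conic = _ at hC
    rw [hconic s hs] at hC
    exact conicOf_injective (by omega) (hγ s hs) (he.ne_zero i hi) hC
  have hadd : ∀ i j, i ≠ j → e i ∈ T → e j ∈ T → e (i + j) ∈ T := by
    rintro i j hij ⟨s, hs, hsi⟩ ⟨t, ht, htj⟩
    have hst : s ≠ t := by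
      rintro rfl
      exact hij (he.γ_injective (by rw [← hsi, ← htj]))
    obtain ⟨hne, hc⟩ := hcl s hs t ht hst
    refine ⟨_, hc, ?_⟩
    change φ _ = _
    rw [ofParam_comp (fun h => hne (CharTwo.add_eq_zero.mp h)), map_add, map_add, ← hsi, ← htj]
  have t1 := hmem _ (by decide) h₁
  have t2 := hmem _ (by decide) h₂
  have t3 := hmem _ (by decide) h₃
  have t12 := hadd _ _ (by decide) t1 t2
  have t13 := hadd _ _ (by decide) t1 t3
  have t23 := hadd _ _ (by decide) t2 t3
  have t123 := hadd _ _ (by decide) t12 t3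
  have hsub : e '' {i | i ≠ 0} ⊆ T := by
    rintro _ ⟨⟨x, y, z⟩, hi, rfl⟩
    rcases zmod_two_cases x with rfl | rfl <;> rcases zmod_two_cases y with rfl | rfl <;>
      rcases zmod_two_cases z with rfl | rfl
    · exact absurd rfl hi
    all_goals assumption
  have hSfin : S.Finite := Set.finite_of_ncard_ne_zero (by omega)
  -- The closed set contains the seven sums of the generators and has only seven members.
  have hTeq : e '' {i | i ≠ 0} = T := by
    refine Set.eq_of_subset_of_ncard_le hsub ?_ (hSfin.image _)
    have hinj : Function.Injective e := fun i j hij => he.γ_injective (by rw [hij])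
    rw [Set.ncard_image_of_injective _ hinj, ncard_idx_ne_zero]
    have := Set.ncard_image_le (f := fun i => φ (ofParam i)) hSfin
    rw [← hT] at this
    omega
  rw [conics, ← Set.image_image conicOf e, hTeq, hT, Set.image_image]
  exact Set.image_congr fun i hi => hconic i hi

end Mathon

/-! ### Disjoint conics generate a family. -/

section Generation

variable {K : Type*} [Field K]

/-- If the `γ` agreed, the difference of the equations would be a binary form in `x²` and `y²`,
hence vanish on a line through `F₀`. That line would be tangent to both conics at the same point. -/
theorem γ_ne_of_disjoint [CharP K 2] [Finite K] {h h' : K × K × K} (hγ : h.2.2 ≠ 0)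
    (hγ' : h'.2.2 ≠ 0) (hd : Disjoint (conicOf h) (conicOf h')) : h.2.2 ≠ h'.2.2 := by
  intro heq
  have h2 : (2 : K) = 0 := two_eq_zero_of_char_two
  choose r hr using exists_sq_eq_of_char_two (K := K)
  obtain ⟨x, y, hxy, hz⟩ : ∃ x y : K, (x ≠ 0 ∨ y ≠ 0) ∧
      (h.1 + h'.1) * x ^ 2 + (h.2.1 + h'.2.1) * y ^ 2 = 0 := by
    by_cases h0 : h.1 + h'.1 = 0
    · exact ⟨1, 0, by simp, by simp [h0]⟩
    · refine ⟨r (h.2.1 + h'.2.1), r (h.1 + h'.1), Or.inr fun hc => h0 ?_, ?_⟩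
      · rw [← hr (h.1 + h'.1), hc]; simp
      · rw [hr, hr]
        linear_combination (h.1 + h'.1) * (h.2.1 + h'.2.1) * h2
  set z := r ((h.1 * x ^ 2 + h.2.2 * x * y + h.2.1 * y ^ 2) / h.2.2 ^ 2) with hzdef
  have hz2 : h.2.2 ^ 2 * z ^ 2 = h.1 * x ^ 2 + h.2.2 * x * y + h.2.1 * y ^ 2 := by
    rw [hzdef, hr]; field_simp
  have hv : (![x, y, z] : Fin 3 → K) ≠ 0 := by
    rw [vec_ne_zero_iff]
    rcases hxy with h | h <;> simp [h]
  have hd' := Set.disjoint_left.mp hd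
  refine @hd' (Projectivization.mk K _ hv) ?_ ?_
  · rw [mk_mem_conicOf hγ]
    simp only [Matrix.cons_val]
    linear_combination hz2 + (h.1 * x ^ 2 + h.2.2 * x * y + h.2.1 * y ^ 2) * h2
  · rw [mk_mem_conicOf hγ', ← heq]
    simp only [Matrix.cons_val]
    linear_combination hz2 + hz + h.2.2 * x * y * h2

variable [Algebra (ZMod 2) K]

/-- The pencil of the two conics contains a double line, which carries all their common points.
Disjointness makes this line external, so the first conic has Arf invariant 1 on it, and that
invariant expands to the sum of the three traces. -/
theorem tr_add_of_disjoint [CharP K 2] [Finite K] {h h' : K × K × K} (hγ : h.2.2 ≠ 0)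
    (hγ' : h'.2.2 ≠ 0) (hd : Disjoint (conicOf h) (conicOf h')) :
    tr ((h + h').1 * (h + h').2.1 / (h + h').2.2 ^ 2) =
      1 + tr (h.1 * h.2.1 / h.2.2 ^ 2) + tr (h'.1 * h'.2.1 / h'.2.2 ^ 2) := by
  have hne := γ_ne_of_disjoint hγ hγ' hd
  have h2 : (2 : K) = 0 := two_eq_zero_of_char_two
  obtain ⟨p, u, γ⟩ := h
  obtain ⟨p', u', γ'⟩ := h'
  simp only [Prod.mk_add_mk] at *
  have hs : γ + γ' ≠ 0 := fun hc => hne (CharTwo.add_eq_zero.mp hc)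
  obtain ⟨α, rfl⟩ : ∃ α, p = α * γ := ⟨p / γ, by field_simp⟩
  obtain ⟨β, rfl⟩ : ∃ β, u = β * γ := ⟨u / γ, by field_simp⟩
  obtain ⟨α', rfl⟩ : ∃ α, p' = α * γ' := ⟨p' / γ', by field_simp⟩
  obtain ⟨β', rfl⟩ : ∃ β, u' = β * γ' := ⟨u' / γ', by field_simp⟩
  -- The double line `(α+α')x² + (β+β')y² + (γ+γ')z² = 0` is `z = ax + by` for these square roots.
  obtain ⟨a, ha⟩ := exists_sq_eq_of_char_two ((α + α') / (γ + γ'))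
  obtain ⟨b, hb⟩ := exists_sq_eq_of_char_two ((β + β') / (γ + γ'))
  have hl : lineArf a b (α * γ, β * γ, γ) = 1 := by
    refine (zmod_two_cases _).resolve_left fun h0 => ?_
    have hw := affine_line_ne_zero a b
    obtain ⟨P, Q, -, hPQ⟩ := inter_line_eq_pair (h := (α * γ, β * γ, γ)) hγ hw (by simp)
      (by simpa using h0)
    have hP : P ∈ conicOf (α * γ, β * γ, γ) ∩ line (Projectivization.mk K _ hw) := by
      rw [hPQ]; simp
    induction P using Projectivization.ind with
    | h v hv =>
      obtain ⟨hC, hPl⟩ := hP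
      refine Set.disjoint_left.mp hd hC ?_
      rw [mem_line_iff hw (by simp)] at hPl
      rw [mk_mem_conicOf hγ] at hC
      rw [mk_mem_conicOf hγ']
      simp only [Matrix.cons_val, div_one] at hPl hC ⊢
      rw [eq_div_iff hs] at ha hb
      apply mul_left_cancel₀ hγ
      have hsq : v 2 ^ 2 = a ^ 2 * v 0 ^ 2 + b ^ 2 * v 1 ^ 2 := by
        rw [hPl, CharTwo.add_sq]; ring
      have hD : (α + α') * v 0 ^ 2 + (β + β') * v 1 ^ 2 + (γ + γ') * v 2 ^ 2 = 0 := by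
        linear_combination (γ + γ') * hsq - v 0 ^ 2 * ha - v 1 ^ 2 * hb +
          (γ + γ') * (a ^ 2 * v 0 ^ 2 + b ^ 2 * v 1 ^ 2) * h2
      linear_combination γ' * hC + γ * γ' * hD - (γ * γ' * α * v 0 ^ 2 + γ * γ' * β * v 1 ^ 2 +
        γ ^ 2 * γ' * v 2 ^ 2) * h2
  have h3 : (α * γ + γ ^ 2 * a ^ 2) * (β * γ + γ ^ 2 * b ^ 2) / γ ^ 2 =
      (α * γ + α' * γ') * (β * γ + β' * γ') / (γ + γ') ^ 2 + α * γ * (β * γ) / γ ^ 2 +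
        α' * γ' * (β' * γ') / γ' ^ 2 := by
    rw [ha, hb]
    field_simp
    linear_combination (α * γ * γ' * β + α * γ ^ 2 * β + α * γ ^ 2 * β' - γ * γ' * α' * β' +
      γ ^ 2 * α' * β - γ' ^ 2 * α' * β') * h2
  simp only [lineArf, tr] at hl ⊢
  rw [h3, map_add, map_add] at hl
  rw [← hl]
  generalize (Algebra.trace (ZMod 2) K) ((α * γ + α' * γ') * (β * γ + β' * γ') / (γ + γ') ^ 2) = x
  generalize (Algebra.trace (ZMod 2) K) (α * γ * (β * γ) / γ ^ 2) = y
  generalize (Algebra.trace (ZMod 2) K) (α' * γ' * (β' * γ') / γ' ^ 2) = z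
  revert x y z
  decide

/-- The additive family generated by three conics. -/
def family (c₁ c₂ c₃ : K × K × K) : Idx →+ K × K × K where
  toFun i := i.1 • c₁ + i.2.1 • c₂ + i.2.2 • c₃
  map_zero' := by simp
  map_add' i j := by
    simp only [Prod.fst_add, Prod.snd_add, add_smul]
    abel

theorem family_apply (c₁ c₂ c₃ : K × K × K) (i : Idx) :
    family c₁ c₂ c₃ i = i.1 • c₁ + i.2.1 • c₂ + i.2.2 • c₃ := rfl

/-- Three conics of a degree `4` arc in the family, and a fourth conic disjoint from them,
generate a family. -/
theorem isArcFamily_of_disjoint [CharP K 2] [Finite K] {c₁ c₂ c₃ : K × K × K}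
    (hγ₁ : c₁.2.2 ≠ 0) (hγ₂ : c₂.2.2 ≠ 0) (hγ₁₂ : (c₁ + c₂).2.2 ≠ 0) (hγ₃ : c₃.2.2 ≠ 0)
    (ht₁ : tr (c₁.1 * c₁.2.1 / c₁.2.2 ^ 2) = 1) (ht₂ : tr (c₂.1 * c₂.2.1 / c₂.2.2 ^ 2) = 1)
    (ht₁₂ : tr ((c₁ + c₂).1 * (c₁ + c₂).2.1 / (c₁ + c₂).2.2 ^ 2) = 1)
    (hd₁ : Disjoint (conicOf c₁) (conicOf c₃)) (hd₂ : Disjoint (conicOf c₂) (conicOf c₃))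
    (hd₁₂ : Disjoint (conicOf (c₁ + c₂)) (conicOf c₃)) :
    ∃ ψ, IsArcFamily (family c₁ c₂ c₃) ψ := by
  have hne : ∀ {h h' : K × K × K}, h.2.2 ≠ 0 → h'.2.2 ≠ 0 →
      Disjoint (conicOf h) (conicOf h') → (h + h').2.2 ≠ 0 := fun hγ hγ' hd hc =>
    γ_ne_of_disjoint hγ hγ' hd (CharTwo.add_eq_zero.mp hc)
  have t₁ := tr_add_of_disjoint hγ₁ hγ₃ hd₁
  have t₂ := tr_add_of_disjoint hγ₂ hγ₃ hd₂
  have t₁₂ := tr_add_of_disjoint hγ₁₂ hγ₃ hd₁₂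
  rw [ht₁] at t₁
  rw [ht₂] at t₂
  rw [ht₁₂] at t₁₂
  set t := tr (c₃.1 * c₃.2.1 / c₃.2.2 ^ 2) with ht
  -- The first two generators have trace 1, so the deviation from 1 depends only on the coefficient
  -- of `c₃`, which contributes `1 + t`.
  refine ⟨(AddMonoidHom.mulLeft (1 + t)).comp
    ((AddMonoidHom.snd _ _).comp (AddMonoidHom.snd _ _)), ?_, ?_⟩
  · rintro ⟨x, y, z⟩ hi
    rcases zmod_two_cases x with rfl | rfl <;> rcases zmod_two_cases y with rfl | rfl <;>
      rcases zmod_two_cases z with rfl | rfl <;>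
      simp only [family_apply, zero_smul, one_smul, zero_add, add_zero]
    · exact absurd rfl hi
    · exact hγ₃
    · exact hγ₂
    · exact hne hγ₂ hγ₃ hd₂
    · exact hγ₁
    · exact hne hγ₁ hγ₃ hd₁
    · exact hγ₁₂
    · exact hne hγ₁₂ hγ₃ hd₁₂
  · rintro ⟨x, y, z⟩ hi
    have e1 : ∀ t : ZMod 2, 1 + 1 + t = 1 + (1 + t) := by decide
    have e2 : ∀ t : ZMod 2, t = 1 + (1 + t) := by decide
    rcases zmod_two_cases x with rfl | rfl <;> rcases zmod_two_cases y with rfl | rfl <;>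
      rcases zmod_two_cases z with rfl | rfl <;>
      simp only [family_apply, zero_smul, one_smul, zero_add, add_zero, AddMonoidHom.comp_apply,
        AddMonoidHom.coe_snd, AddMonoidHom.coe_mulLeft, mul_zero, mul_one]
    · exact absurd rfl hi
    · rw [← ht]; exact e2 t
    · exact ht₂
    · rw [t₂]; exact e1 t
    · exact ht₁
    · rw [t₁]; exact e1 t
    · exact ht₁₂
    · rw [t₁₂]; exact e1 t

end Generation

/-! ### The action of `θ` on the index space as a companion map. -/

section Action

theorem idx_hom_ext {A : Type*} [AddMonoid A] {f g : Idx →+ A} (h₁ : f (1, 0, 0) = g (1, 0, 0))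
    (h₂ : f (0, 1, 0) = g (0, 1, 0)) (h₃ : f (0, 0, 1) = g (0, 0, 1)) : f = g := by
  ext1 ⟨x, y, z⟩
  have h : ((x, y, z) : Idx) = (x, 0, 0) + (0, y, 0) + (0, 0, z) := by simp
  have hx : f (x, 0, 0) = g (x, 0, 0) := by
    rcases zmod_two_cases x with rfl | rfl
    · exact (map_zero f).trans (map_zero g).symm
    · exact h₁
  have hy : f (0, y, 0) = g (0, y, 0) := by
    rcases zmod_two_cases y with rfl | rfl
    · exact (map_zero f).trans (map_zero g).symm
    · exact h₂
  have hz : f (0, 0, z) = g (0, 0, z) := by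
    rcases zmod_two_cases z with rfl | rfl
    · exact (map_zero f).trans (map_zero g).symm
    · exact h₃
  rw [h]
  simp only [map_add, hx, hy, hz]

/-- The companion map `c₁ ↦ c₂ ↦ c₃ ↦ c₁ + ε c₂ + δ c₃`. -/
def companion (ε δ : ZMod 2) : Idx →+ Idx where
  toFun i := (i.2.2, i.1 + ε * i.2.2, i.2.1 + δ * i.2.2)
  map_zero' := by simp
  map_add' i j := by
    ext
    · rfl
    · simp; ring
    · simp; ring

/-- The characteristic polynomial `X³ + (ε+1)X² + εX + 1` has no root in `GF(2)`, so it is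
irreducible and the map is a Singer cycle of order 7. -/
theorem companion_transitive (ε : ZMod 2) :
    ∀ i j : Idx, i ≠ 0 → j ≠ 0 → ∃ n : Fin 7, (companion ε (ε + 1))^[n] i = j := by
  revert ε; decide

/-- Here 1 is a root of the characteristic polynomial, which is `X³ + 1` or `(X + 1)³`. The order is
3 or 4: it divides 12 but not 7. -/
theorem companion_iterate_degenerate (ε : ZMod 2) :
    (companion ε ε)^[7 * 12] (1, 0, 0) = (1, 0, 0) ∧ (companion ε ε)^[7] (1, 0, 0) ≠ (1, 0, 0) := by
  have h1 : ∀ ε i, (companion ε ε)^[12] i = i := by decide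
  have h2 : ∀ ε, (companion ε ε)^[7] (1, 0, 0) ≠ (1, 0, 0) := by decide
  refine ⟨?_, h2 ε⟩
  rw [mul_comm, Function.iterate_mul]
  exact Function.iterate_fixed (h1 ε _) 7

variable {K : Type*} [Field K]

theorem conicAct_γ [CharP K 2] (σ : K ≃+* K) (M : Matrix (Fin 2) (Fin 2) K) (a b : K)
    (h : K × K × K) : (conicAct σ M a b h).2.2 = M.det⁻¹ * σ h.2.2 := by
  change σ h.2.2 / M.det = _
  rw [div_eq_inv_mul]

theorem iterate_semilinear {k : K} (hk : k ≠ 0) (σ : K ≃+* K) (n : ℕ) :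
    ∃ c, c ≠ 0 ∧ ∀ x, (fun x => k * σ x)^[n] x = c * ((σ : RingAut K) ^ n) x := by
  induction n with
  | zero => exact ⟨1, one_ne_zero, fun x => (one_mul x).symm⟩
  | succ n ih =>
    obtain ⟨c, hc, h⟩ := ih
    refine ⟨k * σ c, mul_ne_zero hk (by simpa using hc), fun x => ?_⟩
    rw [Function.iterate_succ_apply', h, pow_succ', RingAut.mul_apply, map_mul, mul_assoc]

theorem smul_conicOf_iterate {g : PGammaL K} {e : Idx →+ K × K × K} {T : Idx → Idx}
    (hT : ∀ i, i ≠ 0 → T i ≠ 0 ∧ g • conicOf (e i) = conicOf (e (T i))) {i : Idx} (hi : i ≠ 0)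
    (n : ℕ) : T^[n] i ≠ 0 ∧ g ^ n • conicOf (e i) = conicOf (e (T^[n] i)) := by
  induction n with
  | zero => exact ⟨hi, one_smul _ _⟩
  | succ n ih =>
    rw [Function.iterate_succ_apply', pow_succ', mul_smul, ih.2]
    exact hT _ ih.1

/-- In a 7-cycle on conics, only powers divisible by 7 fix a conic. -/
theorem seven_dvd_orderOf {g : PGammaL K} {𝒦 : Set (Set (Point K))} (h7 : 𝒦.ncard = 7)
    (hc : (MulAction.toPerm g : Equiv.Perm (Set (Point K))).IsCycleOn 𝒦) {n : ℕ} {C} (hC : C ∈ 𝒦)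
    (hn : g ^ n • C = C) : 7 ∣ n := by
  have hfin : 𝒦.Finite := Set.finite_of_ncard_ne_zero (by omega)
  rw [Set.ncard_eq_toFinset_card _ hfin] at h7
  rw [← h7, ← Equiv.Perm.IsCycleOn.pow_apply_eq (f := MulAction.toPerm g) (a := C) (s := hfin.toFinset)
    (by simpa using hc) (by simpa using hC), ← MulAction.toPermHom_apply, ← map_pow]
  exact hn

theorem companion_ne_zero {ε δ : ZMod 2} {i : Idx} : i ≠ 0 → companion ε δ i ≠ 0 := by
  revert ε δ i; decide

/-- A collineation acting on a family as a nondegenerate companion map permutes its conics in a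
single cycle. -/
theorem isCycleOn_conics {e : Idx →+ K × K × K} {g : PGammaL K} {ε : ZMod 2}
    (h : ∀ i, i ≠ 0 → g • conicOf (e i) = conicOf (e (companion ε (ε + 1) i))) :
    (MulAction.toPerm g : Equiv.Perm (Set (Point K))).IsCycleOn (conics e) := by
  have hiter := fun {i : Idx} (hi : i ≠ 0) (n : ℕ) => smul_conicOf_iterate (g := g)
    (e := e) (T := companion ε (ε + 1)) (fun i hi => ⟨companion_ne_zero hi, h i hi⟩) hi n
  refine ⟨⟨?_, (MulAction.injective g).injOn, ?_⟩, ?_⟩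
  · rintro _ ⟨i, hi, rfl⟩
    exact ⟨_, companion_ne_zero hi, (h i hi).symm⟩
  · rintro _ ⟨i, hi, rfl⟩
    have hi1 : (companion ε (ε + 1)) ((companion ε (ε + 1))^[6] i) = i := by
      have : ∀ ε i, (companion ε (ε + 1)) ((companion ε (ε + 1))^[6] i) = i := by decide
      exact this ε i
    refine ⟨_, ⟨(companion ε (ε + 1))^[6] i, (hiter hi 6).1, rfl⟩, ?_⟩
    change g • conicOf (e _) = conicOf (e i)
    rw [h _ (hiter hi 6).1, hi1]
  · rintro _ ⟨i, hi, rfl⟩ _ ⟨j, hj, rfl⟩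
    obtain ⟨n, hn⟩ := companion_transitive ε i j hi hj
    refine ⟨(n : ℕ), ?_⟩
    have := (hiter hi n).2
    rw [hn] at this
    rw [zpow_natCast, ← MulAction.toPermHom_apply, ← map_pow]
    exact this

variable [Algebra (ZMod 2) K] {e : Idx →+ K × K × K} {ψ : Idx →+ ZMod 2}

theorem IsArcFamily.injective (he : IsArcFamily e ψ) : Function.Injective e :=
  fun _ _ hij => he.γ_injective (by rw [hij])

theorem IsArcFamily.conicOf_inj [CharP K 2] [Finite K] (hK : 6 ≤ Nat.card K)
    (he : IsArcFamily e ψ) {i j : Idx} (hi : i ≠ 0) (hj : j ≠ 0)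
    (h : conicOf (e i) = conicOf (e j)) : i = j :=
  he.injective (conicOf_injective hK (he.ne_zero i hi) (he.ne_zero j hj) h)

theorem IsArcFamily.ncard_conics [CharP K 2] [Finite K] (hK : 6 ≤ Nat.card K)
    (he : IsArcFamily e ψ) : (conics e).ncard = 7 := by
  rw [conics, Set.InjOn.ncard_image, ncard_idx_ne_zero]
  exact fun i hi j hj h => he.conicOf_inj hK hi hj h

/-- If some power of the seventh power of a collineation fixes a conic of a family, then already
the seventh power fixes every conic. -/
theorem IsArcFamily.iterate_seven (hK : Nat.card K = 2 ^ 7) (he : IsArcFamily e ψ) {k : K}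
    (hk : k ≠ 0) {σ : K ≃+* K} {T : Idx → Idx} (hT : ∀ i, (e (T i)).2.2 = k * σ (e i).2.2)
    {i : Idx} (hi : i ≠ 0) {n : ℕ} (hn : Nat.Coprime n 127) (hfix : T^[7 * n] i = i) (j : Idx) :
    T^[7] j = j := by
  -- As `σ⁷ = 1`, seven steps multiply every `γ` by the same `c`. The fixed index gives `c^n = 1`,
  -- hence `c = 1`, and `γ` determines the index.
  obtain ⟨c, hc, h⟩ := iterate_semilinear hk σ 7
  rw [ringEquiv_pow_seven hK σ] at h
  have hT' : ∀ m i, (e (T^[m] i)).2.2 = (fun x => k * σ x)^[m] (e i).2.2 := by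
    intro m i
    induction m with
    | zero => rfl
    | succ m ih => rw [Function.iterate_succ_apply', Function.iterate_succ_apply', hT, ih]
  have h7 : ∀ i, (e (T^[7] i)).2.2 = c * (e i).2.2 := fun i => by rw [hT', h]; rfl
  have h7n : ∀ m i, (e (T^[7 * m] i)).2.2 = c ^ m * (e i).2.2 := by
    intro m i
    induction m with
    | zero => simp
    | succ m ih => rw [Nat.mul_succ, add_comm, Function.iterate_add_apply, h7, ih]; ring
  have hcn := h7n n i
  rw [hfix] at hcn
  have hc1 : c ^ n = 1 := by
    apply mul_right_cancel₀ (he.ne_zero i hi)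
    rw [one_mul, ← hcn]
  have hone := eq_one_of_pow_eq_one hK hc hn hc1
  apply he.γ_injective
  rw [h7, hone, one_mul]

/-- A collineation whose action on the generators of a family is a shift, and which meets the
intersection conditions, acts on the family as a companion map. -/
theorem IsArcFamily.exists_companion [CharP K 2] [Finite K] (hK : 6 ≤ Nat.card K)
    (he : IsArcFamily e ψ) {g : PGammaL K} {σ : K ≃+* K} {M : Matrix (Fin 2) (Fin 2) K} {a b : K}
    (hM : M.det ≠ 0) (hg : IsNormalForm g σ M a b)
    (h₁ : g • conicOf (e (1, 0, 0)) = conicOf (e (0, 1, 0)))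
    (h₂ : g • conicOf (e (0, 1, 0)) = conicOf (e (0, 0, 1))) {𝒟 : Set (Set (Point K))}
    (h𝒟 : 𝒟 = {conicOf (e (0, 1, 0)), conicOf (e (1, 0, 0)), conicOf (e (1, 1, 0))})
    (hD : ∃ C, (g ^ 2 • 𝒟) ∩ 𝒟 = {C}) (hD' : ∃ C, (g ^ 2 • 𝒟) ∩ (g • 𝒟) = {C}) :
    ∃ ε δ, ∀ i, conicAct σ M a b (e i) = e (companion ε δ i) := by
  set φ := conicAct σ M a b with hφ
  have hφγ : ∀ h, h.2.2 ≠ 0 → (φ h).2.2 ≠ 0 := fun h hh => by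
    rw [hφ, conicAct_γ]; exact mul_ne_zero (inv_ne_zero hM) (by simpa using hh)
  have hact : ∀ h, h.2.2 ≠ 0 → g • conicOf h = conicOf (φ h) := fun h hh => hg.smul_conicOf hM hh
  have n1 := he.ne_zero (1, 0, 0) (by decide)
  have n2 := he.ne_zero (0, 1, 0) (by decide)
  have n3 := he.ne_zero (0, 0, 1) (by decide)
  have n4 := he.ne_zero (1, 1, 0) (by decide)
  rw [hact _ n1] at h₁
  rw [hact _ n2] at h₂
  have φ1 := conicOf_injective hK (hφγ _ n1) n2 h₁
  have φ2 := conicOf_injective hK (hφγ _ n2) n3 h₂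
  have φ4 : φ (e (1, 1, 0)) = e (0, 1, 1) := by
    rw [show ((1, 1, 0) : Idx) = (1, 0, 0) + (0, 1, 0) from rfl, map_add, map_add, φ1, φ2,
      ← map_add]
    rfl
  set x := φ (e (0, 0, 1)) with hx
  have φ4' : φ (e (0, 1, 1)) = e (0, 0, 1) + x := by
    rw [show ((0, 1, 1) : Idx) = (0, 1, 0) + (0, 0, 1) from rfl, map_add, map_add, φ2]
  have n5 := he.ne_zero (0, 1, 1) (by decide)
  have hxγ : x.2.2 ≠ 0 := hφγ _ n3
  have hxγ' : (e (0, 0, 1) + x).2.2 ≠ 0 := by rw [← φ4']; exact hφγ _ n5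
  have hg1 : g • 𝒟 = {conicOf (e (0, 0, 1)), conicOf (e (0, 1, 0)), conicOf (e (0, 1, 1))} := by
    rw [h𝒟, Set.smul_set_insert, Set.smul_set_insert, Set.smul_set_singleton, hact _ n1,
      hact _ n2, hact _ n4, φ1, φ2, φ4]
  have hg2 : g ^ 2 • 𝒟 = {conicOf x, conicOf (e (0, 0, 1)), conicOf (e (0, 0, 1) + x)} := by
    rw [sq, mul_smul, hg1, Set.smul_set_insert, Set.smul_set_insert, Set.smul_set_singleton,
      hact _ n3, hact _ n2, hact _ n5, φ2, φ4']
  rw [hg2, h𝒟] at hD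
  rw [hg2, hg1] at hD'
  obtain ⟨C, hC⟩ := hD
  obtain ⟨C', hC'⟩ := hD'
  have hinj := @IsArcFamily.conicOf_inj K _ _ e ψ _ _ hK he
  -- The set `g² 𝒟` consists of `x`, `e₃` and `e₃ + x`, where `e₃` is not in `𝒟`. The conic shared
  -- with `𝒟` is thus `x` or `e₃ + x`, which puts `x` in the family.
  have key : ∃ m : Idx, m ∈ ({(0, 1, 0), (1, 0, 0), (1, 1, 0), (0, 1, 1), (1, 0, 1), (1, 1, 1)} :
      Set Idx) ∧ x = e m := by
    have hCm : C ∈ ({conicOf x, conicOf (e (0, 0, 1)), conicOf (e (0, 0, 1) + x)} :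
        Set (Set (Point K))) ∩ {conicOf (e (0, 1, 0)), conicOf (e (1, 0, 0)),
          conicOf (e (1, 1, 0))} := by rw [hC]; rfl
    obtain ⟨hCl, hCr⟩ := hCm
    obtain ⟨m, hm, rfl⟩ : ∃ m : Idx, m ∈ ({(0, 1, 0), (1, 0, 0), (1, 1, 0)} : Set Idx) ∧
        C = conicOf (e m) := by
      rcases hCr with h | h | h
      · exact ⟨_, by simp, h⟩
      · exact ⟨_, by simp, h⟩
      · exact ⟨_, by simp, h⟩
    have hm0 : m ≠ 0 := by rcases hm with rfl | rfl | rfl <;> decide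
    have hmγ := he.ne_zero m hm0
    rcases hCl with h | h | h
    · refine ⟨m, ?_, (conicOf_injective hK hmγ hxγ h).symm⟩
      rcases hm with rfl | rfl | rfl <;> simp
    · exfalso
      have := hinj hm0 (by decide) h
      rcases hm with rfl | rfl | rfl <;> revert this <;> decide
    · refine ⟨(0, 0, 1) + m, ?_, ?_⟩
      · rcases hm with rfl | rfl | rfl <;> simp
      · rw [map_add, conicOf_injective hK hmγ hxγ' h, ← add_assoc, ← map_add]
        rw [show ((0, 0, 1) + (0, 0, 1) : Idx) = 0 from by decide, map_zero, zero_add]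
  obtain ⟨m, hm, hxm⟩ := key
  have hC3 : conicOf (e (0, 0, 1)) = C' := by
    rw [← Set.mem_singleton_iff, ← hC']
    exact ⟨by simp, by simp⟩
  -- The conic `e₃` already lies in `g² 𝒟 ∩ g 𝒟`, so `x` is neither `e₂` nor `e₂ + e₃`. Its
  -- coefficient at `e₁` is therefore 1.
  have hm1 : m ≠ (0, 1, 0) := by
    rintro rfl
    have h3 : conicOf (e (0, 1, 0)) = C' := by
      rw [← Set.mem_singleton_iff, ← hC']
      exact ⟨by rw [hxm]; simp, by simp⟩
    have := hinj (by decide) (by decide) (h3.trans hC3.symm)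
    revert this; decide
  have hm2 : m ≠ (0, 1, 1) := by
    rintro rfl
    have h3 : conicOf (e (0, 1, 1)) = C' := by
      rw [← Set.mem_singleton_iff, ← hC']
      exact ⟨by rw [hxm]; simp, by simp⟩
    have := hinj (by decide) (by decide) (h3.trans hC3.symm)
    revert this; decide
  refine ⟨m.2.1, m.2.2, fun i => ?_⟩
  have hm3 : m = (1, m.2.1, m.2.2) := by
    rcases hm with rfl | rfl | rfl | rfl | rfl | rfl <;> first | rfl | contradiction
  have hext : φ.comp e = e.comp (companion m.2.1 m.2.2) := by
    apply idx_hom_ext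
    · simpa [companion] using φ1
    · simpa [companion] using φ2
    · simp only [AddMonoidHom.comp_apply, companion, AddMonoidHom.coe_mk, ZeroHom.coe_mk]
      rw [← hx, hxm]
      simp only [mul_one, zero_add, ← hm3]
  exact DFunLike.congr_fun hext i

/-- In the degenerate case the 84th power fixes a conic. As 12 is coprime to 127, the seventh power
would already be trivial on the indices, but it moves one. -/
theorem IsArcFamily.companion_parameters (hK : Nat.card K = 2 ^ 7) [CharP K 2]
    (he : IsArcFamily e ψ) {σ : K ≃+* K} {M : Matrix (Fin 2) (Fin 2) K} {a b : K}
    (hM : M.det ≠ 0) {ε δ : ZMod 2} (h : ∀ i, conicAct σ M a b (e i) = e (companion ε δ i)) :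
    δ = ε + 1 := by
  by_contra hne
  have hδ : δ = ε := by
    have : ∀ x y : ZMod 2, ¬ y = x + 1 → y = x := by decide
    exact this ε δ hne
  subst hδ
  have hT : ∀ i, (e (companion δ δ i)).2.2 = M.det⁻¹ * σ (e i).2.2 := fun i => by
    rw [← h i, conicAct_γ]
  obtain ⟨h1, h2⟩ := companion_iterate_degenerate δ
  exact h2 (he.iterate_seven hK (inv_ne_zero hM) hT (by decide) (n := 12) (by decide) h1 _)

end Action

/-! ### Automorphisms of an arc that fix one of its conics. -/

section Automorphisms

/-- The number of fixed points is congruent to 8 modulo 7, and `0` and `i` already give two, so all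
eight indices are fixed. -/
theorem eq_self_of_iterate_seven {T : Idx → Idx} (h7 : ∀ i, T^[7] i = i) (h0 : T 0 = 0)
    {i : Idx} (hi : i ≠ 0) (hTi : T i = i) (j : Idx) : T j = j := by
  classical
  have hp : Fact (Nat.Prime 7) := ⟨by norm_num⟩
  have hmod := Equiv.Perm.card_fixedPoints_modEq (f := (T : Function.End Idx)) (p := 7) (n := 1) (by
    funext i
    rw [pow_one]
    exact h7 i)
  have hcard : Fintype.card Idx = 8 := rfl
  have hle : Fintype.card (Function.fixedPoints T) ≤ 8 := by
    rw [← hcard]; exact set_fintype_card_le_univ _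
  have h2 : 1 < Fintype.card (Function.fixedPoints T) := by
    rw [Fintype.one_lt_card_iff]
    exact ⟨⟨0, h0⟩, ⟨i, hTi⟩, fun h => hi (congrArg Subtype.val h).symm⟩
  have h8 : Fintype.card (Function.fixedPoints T) = 8 := by
    rw [hcard] at hmod
    unfold Nat.ModEq at hmod
    change 8 % 7 = Fintype.card (Function.fixedPoints T) % 7 at hmod
    omega
  have huniv : Function.fixedPoints T = Set.univ := by
    rw [← hcard, set_fintype_card_eq_univ_iff] at h8
    exact h8
  have : j ∈ Function.fixedPoints T := by rw [huniv]; trivial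
  exact this

variable {K : Type*} [Field K]

/-- An automorphism fixing two conics of a standard pencil stabilizes the line `z = 0`. -/
theorem matrix_of_fixes_pencil [CharP K 2] {M : Matrix (Fin 2) (Fin 2) K} {a b α γ₁ γ₂ : K}
    (hM : M.det ≠ 0) (h₁ : γ₁ ≠ 0) (h₂ : γ₂ ≠ 0) (h₁₂ : γ₁ ≠ γ₂)
    (hf₁ : conicAct (RingEquiv.refl K) M a b (α * γ₁, γ₁, γ₁) = (α * γ₁, γ₁, γ₁))
    (hf₂ : conicAct (RingEquiv.refl K) M a b (α * γ₂, γ₂, γ₂) = (α * γ₂, γ₂, γ₂)) :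
    M.det = 1 ∧ a = 0 ∧ b = 0 ∧ α * M 0 0 ^ 2 + M 0 0 * M 1 0 + M 1 0 ^ 2 = α ∧
      α * M 0 1 ^ 2 + M 0 1 * M 1 1 + M 1 1 ^ 2 = 1 := by
  simp only [conicAct, AddMonoidHom.coe_mk, ZeroHom.coe_mk, Prod.mk.injEq,
    RingEquiv.refl_apply] at hf₁ hf₂
  obtain ⟨p1, u1, g1⟩ := hf₁
  obtain ⟨p2, u2, g2⟩ := hf₂
  have hdet : M.det = 1 := by
    rw [div_eq_iff hM] at g1
    apply mul_left_cancel₀ h₁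
    rw [← g1, mul_one]
  rw [hdet] at p1 u1 p2 u2
  simp only [one_pow, div_one] at p1 u1 p2 u2
  have q1 : α * M 0 0 ^ 2 + M 0 0 * M 1 0 + M 1 0 ^ 2 + γ₁ * a ^ 2 = α := by
    apply mul_left_cancel₀ h₁; linear_combination p1
  have q2 : α * M 0 0 ^ 2 + M 0 0 * M 1 0 + M 1 0 ^ 2 + γ₂ * a ^ 2 = α := by
    apply mul_left_cancel₀ h₂; linear_combination p2
  have w1 : α * M 0 1 ^ 2 + M 0 1 * M 1 1 + M 1 1 ^ 2 + γ₁ * b ^ 2 = 1 := by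
    apply mul_left_cancel₀ h₁; linear_combination u1
  have w2 : α * M 0 1 ^ 2 + M 0 1 * M 1 1 + M 1 1 ^ 2 + γ₂ * b ^ 2 = 1 := by
    apply mul_left_cancel₀ h₂; linear_combination u2
  -- The equations for the two conics differ only in the term `γ a²`.
  have ha : a = 0 := by
    have : (γ₁ - γ₂) * a ^ 2 = 0 := by linear_combination q1 - q2
    simpa [sub_ne_zero.mpr h₁₂] using this
  have hb : b = 0 := by
    have : (γ₁ - γ₂) * b ^ 2 = 0 := by linear_combination w1 - w2
    simpa [sub_ne_zero.mpr h₁₂] using this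
  subst ha hb
  exact ⟨hdet, rfl, rfl, by linear_combination q1, by linear_combination w1⟩

/-- The orthogonal transvection with parameters `r`, `s`, scaled by `ν`. -/
def transvection (ν r s : K) : Matrix (Fin 2) (Fin 2) K :=
  !![1 + ν * r * s, ν * s ^ 2; ν * r ^ 2, 1 + ν * r * s]

theorem det_transvection [CharP K 2] (ν r s : K) : (transvection ν r s).det = 1 := by
  have h2 : (2 : K) = 0 := two_eq_zero_of_char_two
  rw [transvection, Matrix.det_fin_two_of]
  linear_combination ν * r * s * h2

/-- With `u = (s, r)` and `Q = αx² + xy + y²`, the matrix is the orthogonal transvection `w ↦ w +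
B(w, u) Q(u)⁻¹ u`, where `B(w, u) = rx + sy`. It preserves `Q` and the linear form `rx + sy`, and
the conic's part in `x, y` is `γ Q + c (rx + sy)²`. -/
theorem conicAct_transvection [CharP K 2] {α r s : K} (hQ : α * s ^ 2 + r * s + r ^ 2 ≠ 0)
    {h : K × K × K} {c : K} (hp : h.1 = α * h.2.2 + c * r ^ 2) (hu : h.2.1 = h.2.2 + c * s ^ 2) :
    conicAct (RingEquiv.refl K) (transvection (α * s ^ 2 + r * s + r ^ 2)⁻¹ r s) 0 0 h = h := by
  have h2 : (2 : K) = 0 := two_eq_zero_of_char_two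
  obtain ⟨p, u, γ⟩ := h
  simp only at hp hu
  subst hp hu
  simp only [conicAct, AddMonoidHom.coe_mk, ZeroHom.coe_mk, det_transvection,
    RingEquiv.refl_apply, one_pow, div_one, Prod.mk.injEq, and_true]
  set ν := (α * s ^ 2 + r * s + r ^ 2)⁻¹ with hν
  have hνQ : ν * (α * s ^ 2 + r * s + r ^ 2) = 1 := inv_mul_cancel₀ hQ
  simp only [transvection, Matrix.of_apply, Matrix.cons_val]
  constructor
  · linear_combination γ * r ^ 2 * ν * hνQ + (α * γ * ν * r * s + c * r ^ 3 * ν * s +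
      c * r ^ 4 * ν ^ 2 * s ^ 2 + γ * r ^ 2 * ν) * h2
  · linear_combination γ * s ^ 2 * ν * hνQ + (γ * ν * s ^ 2 + γ * ν * r * s + c * s ^ 3 * ν * r +
      c * s ^ 4 * ν ^ 2 * r ^ 2) * h2

variable [Algebra (ZMod 2) K] {e : Idx →+ K × K × K} {ψ : Idx →+ ZMod 2}

/-- Automorphisms of the point set of an arc permute its conics. -/
theorem IsArcFamily.exists_smul_conicOf_eq [CharP K 2] [Finite K] (hK : 37 ≤ Nat.card K)
    (he : IsArcFamily e ψ) {g : PGammaL K} (hg : g ∈ Aut (arcPoints (conics e) (F₀ K))) {i : Idx}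
    (hi : i ≠ 0) : ∃ j, j ≠ 0 ∧ g • conicOf (e i) = conicOf (e j) := by
  have : Finite (Point K) := Quotient.finite _
  by_contra hc
  push Not at hc
  have hle : ∀ j, j ≠ 0 → (conicOf (e j) ∩ g • conicOf (e i)).ncard ≤ 5 := by
    intro j hj
    by_contra h6
    rw [Set.inter_comm] at h6
    exact hc j hj (smul_conicOf_eq_of_ncard g (he.ne_zero i hi) (he.ne_zero j hj) (by omega))
  have hsum := ncard_inter_iUnion (f := fun j => conicOf (e j))
    (fun i j hi hj hij => he.disjoint hi hj hij) (g • conicOf (e i))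
  -- If the image were none of the seven conics, it would share at most five points with each. With
  -- `F₀` that makes at most 36 points, fewer than a conic has.
  have hbound : ∑ j ∈ Finset.univ.filter (fun j : Idx => j ≠ 0),
      (conicOf (e j) ∩ g • conicOf (e i)).ncard ≤ 35 := by
    refine (Finset.sum_le_card_nsmul _ _ 5 fun j hj => hle j (Finset.mem_filter.mp hj).2).trans ?_
    decide
  have hsub : g • conicOf (e i) ⊆
      (⋃₀ ((fun j => conicOf (e j)) '' {j | j ≠ 0}) ∩ g • conicOf (e i)) ∪ {F₀ K} := by
    intro P hP
    have hPX : P ∈ arcPoints (conics e) (F₀ K) := by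
      have hg' : g • arcPoints (conics e) (F₀ K) = arcPoints (conics e) (F₀ K) := hg
      rw [← hg']
      exact Set.smul_set_mono
        (fun Q hQ => Or.inl (show Q ∈ ⋃₀ conics e from ⟨_, ⟨i, hi, rfl⟩, hQ⟩)) hP
    rcases hPX with h | h
    · exact Or.inl ⟨h, hP⟩
    · exact Or.inr h
  have h1 := Set.ncard_le_ncard hsub
  have h2 := Set.ncard_union_le
    (⋃₀ ((fun j => conicOf (e j)) '' {j | j ≠ 0}) ∩ g • conicOf (e i)) {F₀ K}
  rw [hsum, Set.ncard_singleton] at h2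
  rw [Set.ncard_smul_set] at h1
  have h3 := card_le_ncard_conicOf (he.ne_zero i hi)
  omega

theorem smul_F₀_of_smul_conicOf [CharP K 2] [Finite K] {g : PGammaL K} {h h' : K × K × K}
    (hγ : h.2.2 ≠ 0) (hγ' : h'.2.2 ≠ 0) (hg : g • conicOf h = conicOf h') : g • F₀ K = F₀ K := by
  have := (isNucleus_F₀ hγ).smul g
  rw [hg] at this
  exact this.eq_F₀ hγ'

/-- An automorphism of the arc that fixes one of its conics is linear and fixes all of them. -/
theorem IsArcFamily.linear_of_fixes (hK : Nat.card K = 2 ^ 7) [CharP K 2] [Finite K]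
    (he : IsArcFamily e ψ) {g : PGammaL K} (hg : g ∈ Aut (arcPoints (conics e) (F₀ K)))
    (hfix : g • conicOf (e (1, 0, 0)) = conicOf (e (1, 0, 0))) :
    ∃ M a b, M.det ≠ 0 ∧ IsNormalForm g (RingEquiv.refl K) M a b ∧
      ∀ i, conicAct (RingEquiv.refl K) M a b (e i) = e i := by
  have hne := he.ne_zero (1, 0, 0) (by decide)
  have hF := smul_F₀_of_smul_conicOf hne hne hfix
  obtain ⟨σ, hσ⟩ := exists_hasAut g
  obtain ⟨M, a, b, hM, hn⟩ := hσ.exists_isNormalForm hF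
  have hφγ : ∀ h : K × K × K, h.2.2 ≠ 0 → (conicAct σ M a b h).2.2 ≠ 0 := fun h hh => by
    rw [conicAct_γ]; exact mul_ne_zero (inv_ne_zero hM) (by simpa using hh)
  have hT : ∀ i, ∃ j, conicAct σ M a b (e i) = e j := by
    intro i
    by_cases hi : i = 0
    · exact ⟨0, by rw [hi]; simp⟩
    · obtain ⟨j, hj, h⟩ := he.exists_smul_conicOf_eq (by rw [hK]; norm_num) hg hi
      rw [hn.smul_conicOf hM (he.ne_zero i hi)] at h
      exact ⟨j, conicOf_injective (by rw [hK]; norm_num) (hφγ _ (he.ne_zero i hi))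
        (he.ne_zero j hj) h⟩
  choose T hT using hT
  have hT1 : T (1, 0, 0) = (1, 0, 0) := by
    apply he.injective
    rw [← hT]
    rw [hn.smul_conicOf hM hne] at hfix
    exact conicOf_injective (by rw [hK]; norm_num) (hφγ _ hne) hne hfix
  have hT0 : T 0 = 0 := by
    apply he.injective
    rw [← hT]; simp
  -- A fixed conic allows `n = 1` here: the seventh power of the index map is the identity.
  have h7 := he.iterate_seven hK (inv_ne_zero hM) (σ := σ) (T := T)
    (fun i => by rw [← hT, conicAct_γ]) (i := (1, 0, 0)) (by decide) (n := 1) (by decide)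
    (Function.iterate_fixed hT1 _)
  have hTid := eq_self_of_iterate_seven h7 hT0 (i := (1, 0, 0)) (by decide) hT1
  have hφ : ∀ i, conicAct σ M a b (e i) = e i := fun i => by rw [hT, hTid]
  have hne2 := he.ne_zero (0, 1, 0) (by decide)
  have e1 : M.det⁻¹ * σ (e (1, 0, 0)).2.2 = (e (1, 0, 0)).2.2 := by rw [← conicAct_γ, hφ]
  have e2 : M.det⁻¹ * σ (e (0, 1, 0)).2.2 = (e (0, 1, 0)).2.2 := by rw [← conicAct_γ, hφ]
  -- The ratio of two different `γ` is fixed by `σ` and is neither 0 nor 1.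
  have hσ1 : σ = RingEquiv.refl K := by
    apply ringEquiv_eq_refl_of_fixed hK σ (x := (e (0, 1, 0)).2.2 / (e (1, 0, 0)).2.2)
    · rw [map_div₀, ← mul_div_mul_left _ _ (inv_ne_zero hM), e1, e2]
    · exact div_ne_zero hne2 hne
    · rw [Ne, div_eq_one_iff_eq hne]
      intro h
      have := he.γ_injective h
      revert this; decide
  subst hσ1
  exact ⟨M, a, b, hM, hn, hφ⟩

theorem anisotropic_of_tr [CharP K 2] [Finite K] {α r s : K} (hα : tr α = 1)
    (h : r ≠ 0 ∨ s ≠ 0) : α * s ^ 2 + r * s + r ^ 2 ≠ 0 := by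
  intro hc
  have := tr_eq_zero_of_isotropic (P := α) (U := 1) (γ := 1) (x := s) (y := r) one_ne_zero
    (by linear_combination hc) h.symm
  rw [mul_one, one_pow, div_one, hα] at this
  exact one_ne_zero this

/-- The linear maps of determinant one preserving two quadratic forms with the same polar form. -/
theorem eq_one_or_transvection [CharP K 2] [Finite K] {M : Matrix (Fin 2) (Fin 2) K}
    {α r s : K} (hα : tr α = 1) (hrs : r ≠ 0 ∨ s ≠ 0) (hdet : M.det = 1)
    (hl₀ : r * M 0 0 + s * M 1 0 = r) (hl₁ : r * M 0 1 + s * M 1 1 = s)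
    (hq₀ : α * M 0 0 ^ 2 + M 0 0 * M 1 0 + M 1 0 ^ 2 = α)
    (hq₁ : α * M 0 1 ^ 2 + M 0 1 * M 1 1 + M 1 1 ^ 2 = 1) :
    M = 1 ∨ M = transvection (α * s ^ 2 + r * s + r ^ 2)⁻¹ r s := by
  have h2 : (2 : K) = 0 := two_eq_zero_of_char_two
  rw [Matrix.det_fin_two] at hdet
  -- Determinant 1 and invariance of `rx + sy` already force `M w = w + ν (rx + sy)(s, r)`.
  obtain ⟨ν, h00, h01, h10, h11⟩ : ∃ ν, M 0 0 = 1 + ν * r * s ∧ M 0 1 = ν * s ^ 2 ∧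
      M 1 0 = ν * r ^ 2 ∧ M 1 1 = 1 + ν * r * s := by
    by_cases hr : r = 0
    · subst hr
      have hs : s ≠ 0 := by simpa using hrs
      have m10 : M 1 0 = 0 := by simpa [hs] using hl₀
      have m11 : M 1 1 = 1 := by
        apply mul_left_cancel₀ hs; linear_combination hl₁
      rw [m10, m11] at hdet
      refine ⟨M 0 1 / s ^ 2, ?_, ?_, ?_, ?_⟩
      · linear_combination hdet
      · field_simp
      · rw [m10]; ring
      · rw [m11]; ring
    · obtain ⟨ν, hν⟩ : ∃ ν, M 1 0 = ν * r ^ 2 := ⟨M 1 0 / r ^ 2, by field_simp⟩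
      have h00 : M 0 0 = 1 + ν * r * s := by
        apply mul_left_cancel₀ hr
        rw [hν] at hl₀
        linear_combination hl₀ - ν * r ^ 2 * s * h2
      have h11 : M 1 1 = 1 + ν * r * s := by
        rw [hν, h00] at hdet
        linear_combination hdet + ν * r * hl₁ - ν * r * s * M 1 1 * h2
      refine ⟨ν, h00, ?_, hν, h11⟩
      apply mul_left_cancel₀ hr
      rw [h11] at hl₁
      linear_combination hl₁ - ν * r * s ^ 2 * h2
  have hQ := anisotropic_of_tr hα hrs
  -- Invariance of the quadratic form `Q = αx² + xy + y²` leaves `ν (ν Q(s, r) - 1) = 0`.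
  have hor : ν = 0 ∨ ν * (α * s ^ 2 + r * s + r ^ 2) = 1 := by
    rw [h00, h10] at hq₀
    rw [h01, h11] at hq₁
    have e0 : r ^ 2 * (ν * (ν * (α * s ^ 2 + r * s + r ^ 2) - 1)) = 0 := by
      linear_combination hq₀ - (α * ν * r * s + ν * r ^ 2) * h2
    have e1 : s ^ 2 * (ν * (ν * (α * s ^ 2 + r * s + r ^ 2) - 1)) = 0 := by
      linear_combination hq₁ - (ν * s ^ 2 + ν * r * s) * h2
    have e2 : ν * (ν * (α * s ^ 2 + r * s + r ^ 2) - 1) = 0 := by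
      rcases hrs with h | h
      · exact (mul_eq_zero.mp e0).resolve_left (pow_ne_zero 2 h)
      · exact (mul_eq_zero.mp e1).resolve_left (pow_ne_zero 2 h)
    rcases mul_eq_zero.mp e2 with h | h
    · exact Or.inl h
    · exact Or.inr (sub_eq_zero.mp h)
  rcases hor with rfl | hν
  · left
    ext i j
    fin_cases i <;> fin_cases j <;> simp [h00, h01, h10, h11]
  · right
    rw [← eq_inv_of_mul_eq_one_left hν]
    ext i j
    fin_cases i <;> fin_cases j <;> simp [h00, h01, h10, h11, transvection]

end Automorphisms

/-! ### The Singer property: group order 14 or a sharply transitive group. -/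

section Singer

variable {K : Type*} [Field K]

theorem smul_eq_of_isCycleOn {g : PGammaL K} {𝒦 : Set (Set (Point K))}
    (hc : (MulAction.toPerm g : Equiv.Perm (Set (Point K))).IsCycleOn 𝒦) : g • 𝒦 = 𝒦 :=
  hc.1.image_eq

/-- Since `n ≡ -1` modulo 7, the power `g ^ n` acts as the inverse 7-cycle; as its own seventh power
is trivial, no nontrivial element of the group it generates fixes a conic. -/
theorem actsSharplyTransitively_zpowers {g : PGammaL K} {𝒦 : Set (Set (Point K))}
    (h7 : 𝒦.ncard = 7) (hc : (MulAction.toPerm g : Equiv.Perm (Set (Point K))).IsCycleOn 𝒦)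
    {n : ℕ} (hn : n % 7 = 6) (hg : (g ^ n) ^ 7 = 1) :
    ActsSharplyTransitively (Subgroup.zpowers (g ^ n)) 𝒦 := by
  have hfin : 𝒦.Finite := Set.finite_of_ncard_ne_zero (by omega)
  rw [Set.ncard_eq_toFinset_card _ hfin] at h7
  have hc' : (MulAction.toPerm g : Equiv.Perm (Set (Point K))).IsCycleOn hfin.toFinset := by
    simpa using hc
  refine ⟨?_, fun C hC C' hC' => ?_⟩
  · have hle : Subgroup.zpowers (g ^ n) ≤ MulAction.stabilizer (PGammaL K) 𝒦 := by
      rw [Subgroup.zpowers_le]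
      exact pow_mem (show g ∈ MulAction.stabilizer (PGammaL K) 𝒦 from smul_eq_of_isCycleOn hc) n
    exact fun f hf => hle hf
  · have hCf : C ∈ hfin.toFinset := by simpa using hC
    obtain ⟨m, -, hm⟩ := hc'.exists_pow_eq hCf (by simpa using hC')
    have hpow : ∀ k : ℕ, g ^ k • C = ((MulAction.toPerm g : Equiv.Perm (Set (Point K))) ^ k) C := by
      intro k
      rw [← MulAction.toPermHom_apply, ← map_pow]; rfl
    have hzpow : ∀ k : ℤ, g ^ k • C = ((MulAction.toPerm g : Equiv.Perm (Set (Point K))) ^ k) C := by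
      intro k
      rw [← MulAction.toPermHom_apply, ← map_zpow]; rfl
    -- The factor 6 is the inverse of `n` modulo 7, because `6 · 6 ≡ 1`.
    have hmem : ((g ^ n) ^ (6 * m)) • C = C' := by
      rw [← pow_mul, hpow, ← hm, hc'.pow_apply_eq_pow_apply hCf, h7]
      have : n * (6 * m) ≡ 6 * (6 * m) [MOD 7] := Nat.ModEq.mul_right _ hn
      refine this.trans ?_
      rw [← mul_assoc]
      exact (Nat.ModEq.mul_right m (show 6 * 6 ≡ 1 [MOD 7] from rfl)).trans (by rw [one_mul])
    refine ⟨(g ^ n) ^ (6 * m), ⟨Subgroup.npow_mem_zpowers _ _, hmem⟩, ?_⟩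
    rintro f ⟨hf, hfC⟩
    have hq : ((g ^ n) ^ (6 * m))⁻¹ * f ∈ Subgroup.zpowers (g ^ n) :=
      mul_mem (inv_mem (Subgroup.npow_mem_zpowers _ _)) hf
    have hqC : (((g ^ n) ^ (6 * m))⁻¹ * f) • C = C := by
      rw [mul_smul, hfC, ← hmem, inv_smul_smul]
    obtain ⟨k, hk⟩ := hq
    simp only at hk
    rw [← hk, ← zpow_natCast g n, ← zpow_mul, hzpow, hc'.zpow_apply_eq hCf, h7] at hqC
    have hk7 : (7 : ℤ) ∣ k := by
      have : IsCoprime ((7 : ℕ) : ℤ) (n : ℤ) :=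
        Nat.isCoprime_iff_coprime.mpr
          ((Nat.Prime.coprime_iff_not_dvd (by norm_num)).mpr (by omega))
      exact this.dvd_of_dvd_mul_left hqC
    obtain ⟨l, rfl⟩ := hk7
    rw [zpow_mul, zpow_ofNat, hg, one_zpow] at hk
    rw [eq_comm, inv_mul_eq_one] at hk
    exact hk.symm

theorem mem_aut_of_smul_conics {e : Idx →+ K × K × K} {g : PGammaL K} (hF : g • F₀ K = F₀ K)
    (hc : g • conics e = conics e) : g ∈ Aut (arcPoints (conics e) (F₀ K)) := by
  change g • arcPoints (conics e) (F₀ K) = _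
  rw [← arcPoints_smul, hc, hF]

variable [Algebra (ZMod 2) K] {e : Idx →+ K × K × K} {ψ : Idx →+ ZMod 2}

/-- The group of a proper Mathon arc with a cyclic collineation has order `14`. -/
theorem IsArcFamily.card_aut (hK : Nat.card K = 2 ^ 7) [CharP K 2] [Finite K]
    (he : IsArcFamily e ψ) {α γ₁ γ₂ : K} (hα : tr α = 1)
    (he₁ : e (1, 0, 0) = (α * γ₁, γ₁, γ₁)) (he₂ : e (0, 1, 0) = (α * γ₂, γ₂, γ₂))
    (he₃ : (e (0, 0, 1)).1 ≠ α * (e (0, 0, 1)).2.2 ∨ (e (0, 0, 1)).2.1 ≠ (e (0, 0, 1)).2.2)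
    {θ : PGammaL K} (hF : θ • F₀ K = F₀ K)
    (hc : (MulAction.toPerm θ : Equiv.Perm (Set (Point K))).IsCycleOn (conics e)) :
    Nat.card (Aut (arcPoints (conics e) (F₀ K))) = 14 := by
  have hγ₁ : γ₁ ≠ 0 := by have := he.ne_zero (1, 0, 0) (by decide); rwa [he₁] at this
  have hγ₂ : γ₂ ≠ 0 := by have := he.ne_zero (0, 1, 0) (by decide); rwa [he₂] at this
  have hγ₁₂ : γ₁ ≠ γ₂ := by
    intro h
    have := he.γ_injective (i := (1, 0, 0)) (j := (0, 1, 0)) (by rw [he₁, he₂, h])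
    revert this; decide
  -- The third generator is `γ(αx² + xy + y²)` plus the square of `rx + sy`, up to the `z²` term.
  -- This linear form is nonzero because the generator lies outside the pencil, and it defines the
  -- transvection.
  obtain ⟨r, hr⟩ := exists_sq_eq_of_char_two ((e (0, 0, 1)).1 - α * (e (0, 0, 1)).2.2)
  obtain ⟨s, hs⟩ := exists_sq_eq_of_char_two ((e (0, 0, 1)).2.1 - (e (0, 0, 1)).2.2)
  have hrs : r ≠ 0 ∨ s ≠ 0 := by
    refine he₃.imp (fun h h0 => h ?_) (fun h h0 => h ?_)
    · rw [← sub_eq_zero, ← hr, h0]; simp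
    · rw [← sub_eq_zero, ← hs, h0]; simp
  have hQ := anisotropic_of_tr hα hrs
  set A := Aut (arcPoints (conics e) (F₀ K)) with hA
  set C := conicOf (e (1, 0, 0)) with hC
  have hCm : C ∈ conics e := ⟨_, by decide, rfl⟩
  have hθA : θ ∈ A := mem_aut_of_smul_conics hF (smul_eq_of_isCycleOn hc)
  have horb : MulAction.orbit A C = conics e := by
    ext D
    constructor
    · rintro ⟨g, rfl⟩
      obtain ⟨j, hj, h⟩ := he.exists_smul_conicOf_eq (by rw [hK]; norm_num) g.2
        (i := (1, 0, 0)) (by decide)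
      exact ⟨j, hj, h.symm⟩
    · intro hD
      obtain ⟨n, hn⟩ := hc.2 hCm hD
      refine ⟨⟨θ ^ n, zpow_mem hθA n⟩, ?_⟩
      rw [← MulAction.toPermHom_apply, ← map_zpow] at hn
      exact hn
  set T := transvection (α * s ^ 2 + r * s + r ^ 2)⁻¹ r s with hT
  have hTdet : T.det ≠ 0 := by rw [hT, det_transvection]; exact one_ne_zero
  obtain ⟨τ, hτ⟩ := exists_of_isNormalForm hTdet 0 0
  have hτe : ∀ i, conicAct (RingEquiv.refl K) T 0 0 (e i) = e i := by
    have : (conicAct (RingEquiv.refl K) T 0 0).comp e = e := by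
      apply idx_hom_ext
      · exact conicAct_transvection hQ (c := 0) (by rw [he₁]; simp) (by rw [he₁]; simp)
      · exact conicAct_transvection hQ (c := 0) (by rw [he₂]; simp) (by rw [he₂]; simp)
      · exact conicAct_transvection hQ (c := 1) (by rw [hr]; ring) (by rw [hs]; ring)
    exact fun i => DFunLike.congr_fun this i
  have hτC : ∀ i, i ≠ 0 → τ • conicOf (e i) = conicOf (e i) := fun i hi => by
    rw [hτ.smul_conicOf hTdet (he.ne_zero i hi), hτe]
  have hτA : τ ∈ A := by
    apply mem_aut_of_smul_conics hτ.smul_F₀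
    rw [conics, ← Set.image_smul, Set.image_image]
    exact Set.image_congr hτC
  have hτ1 : τ ≠ 1 := by
    rintro rfl
    have hfix : ∀ w : Fin 3 → K, w ≠ 0 → ∃ c : K, c * w 0 = T 0 0 * w 0 + T 0 1 * w 1 ∧
        c * w 1 = T 1 0 * w 0 + T 1 1 * w 1 := by
      intro w hw
      obtain ⟨v, hv, e0, e1, e2⟩ := exists_preimage_vec (RingEquiv.refl K) 0 0 hTdet hw
      have h := hτ v w hv hw e0 e1 e2
      rw [one_smul, Projectivization.mk_eq_mk_iff'] at h
      obtain ⟨c, rfl⟩ := h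
      exact ⟨c, e0, e1⟩
    have hν := inv_ne_zero hQ
    rcases hrs with h | h
    · obtain ⟨c, -, h1⟩ := hfix ![1, 0, 0] (fun h => one_ne_zero (congrFun h 0))
      simp [hT, transvection, h, hQ] at h1
    · obtain ⟨c, h0, -⟩ := hfix ![0, 1, 0] (fun h => one_ne_zero (congrFun h 1))
      simp [hT, transvection, h, hQ] at h0
  -- Fixing all three generators makes the matrix preserve both `αx² + xy + y²` and `rx + sy`; orbit
  -- and stabilizer then give `7 · 2`.
  have hstab : Nat.card (MulAction.stabilizer A C) = 2 := by
    rw [Nat.card_eq_two_iff]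
    refine ⟨1, ⟨⟨τ, hτA⟩, hτC _ (by decide)⟩, ?_, ?_⟩
    · intro h
      exact hτ1 (congrArg (fun x : MulAction.stabilizer A C => ((x : A) : PGammaL K)) h).symm
    · rw [Set.eq_univ_iff_forall]
      rintro ⟨⟨g, hgA⟩, hgC⟩
      obtain ⟨M, a, b, hM, hn, hfix⟩ := he.linear_of_fixes hK hgA hgC
      have f1 := hfix (1, 0, 0)
      have f2 := hfix (0, 1, 0)
      have f3 := hfix (0, 0, 1)
      rw [he₁] at f1
      rw [he₂] at f2
      obtain ⟨hdet, rfl, rfl, q0, q1⟩ := matrix_of_fixes_pencil hM hγ₁ hγ₂ hγ₁₂ f1 f2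
      have f31 := congrArg Prod.fst f3
      have f32 := congrArg (fun x => x.2.1) f3
      simp only [conicAct, AddMonoidHom.coe_mk, ZeroHom.coe_mk, hdet, one_pow, div_one,
        RingEquiv.refl_apply] at f31 f32
      have l0 : r * M 0 0 + s * M 1 0 = r := by
        rw [← sq_eq_sq_iff_of_char_two, CharTwo.add_sq, mul_pow, mul_pow, hr, hs]
        linear_combination f31 - (e (0, 0, 1)).2.2 * q0
      have l1 : r * M 0 1 + s * M 1 1 = s := by
        rw [← sq_eq_sq_iff_of_char_two, CharTwo.add_sq, mul_pow, mul_pow, hr, hs]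
        linear_combination f32 - (e (0, 0, 1)).2.2 * q1
      rcases eq_one_or_transvection hα hrs hdet l0 l1 q0 q1 with h | h
      · left
        apply Subtype.ext
        apply Subtype.ext
        subst h
        exact hn.eq hM isNormalForm_one
      · right
        apply Subtype.ext
        apply Subtype.ext
        subst h
        exact hn.eq hM hτ
  have hindex := Subgroup.card_mul_index (MulAction.stabilizer A C)
  rw [MulAction.index_stabilizer, horb, hstab, he.ncard_conics (by rw [hK]; norm_num)] at hindex
  exact hindex.symm

theorem IsArcFamily.isDennistonArc [CharP K 2] [Finite K] (hK : 8 ≤ Nat.card K)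
    (he : IsArcFamily e ψ) {α : K} (hα : tr α = 1)
    (h : ∀ i, e i = (α * (e i).2.2, (e i).2.2, (e i).2.2)) : IsDennistonArc 8 (conics e) (F₀ K) := by
  set f : Idx →+ K := ((AddMonoidHom.snd K K).comp (AddMonoidHom.snd K (K × K))).comp e with hf
  have hfe : ∀ i, f i = (e i).2.2 := fun i => rfl
  have hinj : Function.Injective f := fun i j hij => he.γ_injective hij
  have hconic : ∀ i, i ≠ 0 → conicOf (e i) = conic α 1 (f i) := by
    intro i hi
    have hγ := he.ne_zero i hi
    rw [hfe, conicOf]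
    rw [h i]
    simp [hγ]
  refine ⟨he.isMaximalArc hK, α, f.range, 1, hα, ?_, ?_, (one_smul _ _).symm⟩
  · rw [← Nat.card_congr (AddMonoidHom.ofInjective hinj).toEquiv]
    simp
  · ext C
    simp only [one_smul]
    constructor
    · rintro ⟨i, hi, rfl⟩
      exact ⟨f i, ⟨⟨i, rfl⟩, he.ne_zero i hi⟩, (hconic i hi).symm⟩
    · rintro ⟨_, ⟨⟨i, rfl⟩, h0⟩, rfl⟩
      have hi : i ≠ 0 := by rintro rfl; exact h0 (map_zero f)
      exact ⟨i, hi, hconic i hi⟩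

/-- A cyclic collineation has a power of order `7` coprime to its action. -/
theorem IsArcFamily.exists_sharplyTransitive (hK : Nat.card K = 2 ^ 7) [CharP K 2] [Finite K]
    (he : IsArcFamily e ψ) {α γ₁ γ₂ : K}
    (he₁ : e (1, 0, 0) = (α * γ₁, γ₁, γ₁)) (he₂ : e (0, 1, 0) = (α * γ₂, γ₂, γ₂))
    {θ : PGammaL K}
    (hc : (MulAction.toPerm θ : Equiv.Perm (Set (Point K))).IsCycleOn (conics e)) :
    ∃ G : Subgroup (PGammaL K), ActsSharplyTransitively G (conics e) := by
  have := Fintype.ofFinite K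
  have hγ₁ : γ₁ ≠ 0 := by have := he.ne_zero (1, 0, 0) (by decide); rwa [he₁] at this
  have hγ₂ : γ₂ ≠ 0 := by have := he.ne_zero (0, 1, 0) (by decide); rwa [he₂] at this
  have hγ₁₂ : γ₁ ≠ γ₂ := by
    intro h
    have := he.γ_injective (i := (1, 0, 0)) (j := (0, 1, 0)) (by rw [he₁, he₂, h])
    revert this; decide
  have h7 := he.ncard_conics (by rw [hK]; norm_num)
  have hfin : (conics e).Finite := Set.finite_of_ncard_ne_zero (by omega)
  have h7' := h7
  rw [Set.ncard_eq_toFinset_card _ hfin] at h7'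
  have hfix : ∀ i, i ≠ 0 → θ ^ 7 • conicOf (e i) = conicOf (e i) := by
    intro i hi
    have hc' : (MulAction.toPerm θ : Equiv.Perm (Set (Point K))).IsCycleOn hfin.toFinset := by
      simpa using hc
    have := (hc'.pow_apply_eq (a := conicOf (e i)) (by simpa using ⟨i, hi, rfl⟩)
      (n := 7)).mpr (by rw [h7'])
    rw [← MulAction.toPermHom_apply, ← map_pow] at this
    exact this
  obtain ⟨σ, hσ⟩ := exists_hasAut θ
  have hσ7 := hσ.pow 7
  rw [ringEquiv_pow_seven hK σ] at hσ7
  have hF7 : θ ^ 7 • F₀ K = F₀ K := smul_F₀_of_smul_conicOf (he.ne_zero (1, 0, 0) (by decide))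
    (he.ne_zero (1, 0, 0) (by decide)) (hfix _ (by decide))
  obtain ⟨M, a, b, hM, hn⟩ := hσ7.exists_isNormalForm hF7
  have hφ : ∀ i, i ≠ 0 → conicAct (RingEquiv.refl K) M a b (e i) = e i := by
    intro i hi
    have h1 := hfix i hi
    rw [hn.smul_conicOf hM (he.ne_zero i hi)] at h1
    refine conicOf_injective (by rw [hK]; norm_num) ?_ (he.ne_zero i hi) h1
    rw [conicAct_γ]
    exact mul_ne_zero (inv_ne_zero hM) (he.ne_zero i hi)
  have f1 := hφ (1, 0, 0) (by decide)
  have f2 := hφ (0, 1, 0) (by decide)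
  rw [he₁] at f1
  rw [he₂] at f2
  obtain ⟨-, rfl, rfl, -, -⟩ := matrix_of_fixes_pencil hM hγ₁ hγ₂ hγ₁₂ f1 f2
  -- The collineation `θ⁷` is linear and given by a matrix in `GL(2, K)`, so its `E`-th power is
  -- trivial. Since `E ≡ (4 - 1)(4 - 2) = 6` modulo 7, the power `θ ^ E` still acts as a 7-cycle
  -- while `(θ ^ E) ^ 7 = 1`.
  set E := Nat.card (GL (Fin 2) K) with hE
  have hEval : E % 7 = 6 := by
    rw [hE, Matrix.card_GL_field, ← Nat.card_eq_fintype_card, hK, Fin.prod_univ_two]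
    norm_num
  have hME : M ^ E = 1 := by
    have h1 : (Matrix.GeneralLinearGroup.mkOfDetNeZero M hM) ^ E = 1 := pow_card_eq_one'
    have h2 := congrArg (fun g : GL (Fin 2) K => (g : Matrix (Fin 2) (Fin 2) K)) h1
    simp only [Units.val_pow_eq_pow_val, Units.val_one] at h2
    exact h2
  have hone : (θ ^ 7) ^ E = 1 := by
    have h1 := hn.pow hM E
    rw [hME] at h1
    exact h1.eq (by simp) isNormalForm_one
  exact ⟨_, actsSharplyTransitively_zpowers h7 hc hEval (by rw [← pow_mul, mul_comm, pow_mul, hone])⟩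

end Singer

/-! ### Invariance of the notions and of the conclusion under collineations. -/

section Transport

variable {K : Type*} [Field K]

theorem ActsSharplyTransitively.smul {G : Subgroup (PGammaL K)} {𝒞 : Set (Set (Point K))}
    (h : ActsSharplyTransitively G 𝒞) (g : PGammaL K) :
    ActsSharplyTransitively (G.map (MulAut.conj g).toMonoidHom) (g • 𝒞) := by
  refine ⟨?_, ?_⟩
  · rintro _ ⟨f, hf, rfl⟩
    change (g * f * g⁻¹) • g • 𝒞 = g • 𝒞
    rw [mul_smul, inv_smul_smul, mul_smul, h.1 f hf]
  · rintro _ ⟨C, hC, rfl⟩ _ ⟨C', hC', rfl⟩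
    obtain ⟨f, ⟨hf, hfC⟩, hu⟩ := h.2 C hC C' hC'
    refine ⟨g * f * g⁻¹, ⟨⟨f, hf, rfl⟩, ?_⟩, ?_⟩
    · change (g * f * g⁻¹) • g • C = g • C'
      rw [mul_smul, inv_smul_smul, mul_smul, hfC]
    · rintro _ ⟨⟨f', hf', rfl⟩, hC''⟩
      change (g * f' * g⁻¹) • g • C = g • C' at hC''
      rw [mul_smul, inv_smul_smul, mul_smul, smul_left_cancel_iff] at hC''
      rw [← hu f' ⟨hf', hC''⟩]
      rfl

variable [Algebra (ZMod 2) K]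

theorem IsDennistonArc.smul {d : ℕ} {𝒞 : Set (Set (Point K))} {N : Point K}
    (h : IsDennistonArc d 𝒞 N) (g : PGammaL K) : IsDennistonArc d (g • 𝒞) (g • N) := by
  obtain ⟨hm, α, H, g', hα, hc, rfl, rfl⟩ := h
  refine ⟨by rw [arcPoints_smul]; exact hm.smul g, α, H, g * g', hα, hc, ?_, by rw [mul_smul]⟩
  rw [← Set.image_smul, Set.image_image]
  simp only [mul_smul]

theorem IsSingerArc.smul {𝒞 : Set (Set (Point K))} {N : Point K}
    (h : IsSingerArc 𝒞 N) (g : PGammaL K) : IsSingerArc (g • 𝒞) (g • N) := by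
  rcases h with ⟨hm, hd, hc⟩ | ⟨hd, G, hG⟩
  · refine Or.inl ⟨hm.smul g, fun hd' => hd ?_, ?_⟩
    · have := hd'.smul g⁻¹
      rwa [inv_smul_smul, inv_smul_smul] at this
    · rw [arcPoints_smul, Aut, MulAction.stabilizer_smul_eq_stabilizer_map_conj, ← hc]
      exact (Nat.card_congr (Subgroup.equivMapOfInjective _ _
        (MulAut.conj g).injective).toEquiv).symm
  · exact Or.inr ⟨hd.smul g, _, hG.smul g⟩

/-- The conclusion of the main theorem: the conics `C₁`, `C₂`, `C₃` and `θ • C₁` lie in a unique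
Mathon arc of degree `8`, which is a Singer arc whose conics are permuted cyclically by `θ`. -/
def GeneratesSingerArc (C₁ C₂ C₃ : Set (Point K)) (N : Point K) (θ : PGammaL K) : Prop :=
  (∃ 𝒦 : Set (Set (Point K)),
    IsMathonArc 8 𝒦 N ∧ C₁ ∈ 𝒦 ∧ C₂ ∈ 𝒦 ∧ C₃ ∈ 𝒦 ∧ θ • C₁ ∈ 𝒦 ∧
    (∀ (𝒦' : Set (Set (Point K))) (N' : Point K), IsMathonArc 8 𝒦' N' →
      C₁ ∈ 𝒦' → C₂ ∈ 𝒦' → C₃ ∈ 𝒦' → θ • C₁ ∈ 𝒦' → 𝒦' = 𝒦 ∧ N' = N) ∧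
    IsSingerArc 𝒦 N ∧
    𝒦.ncard = 7 ∧ (MulAction.toPerm θ : Equiv.Perm (Set (Point K))).IsCycleOn 𝒦) ∧
  7 ∣ orderOf θ

theorem GeneratesSingerArc.smul {C₁ C₂ C₃ : Set (Point K)} {N : Point K} {θ : PGammaL K}
    (h : GeneratesSingerArc C₁ C₂ C₃ N θ) (g : PGammaL K) :
    GeneratesSingerArc (g • C₁) (g • C₂) (g • C₃) (g • N) (g * θ * g⁻¹) := by
  obtain ⟨⟨𝒦, hm, m1, m2, m3, m4, hu, hs, hc, hcyc⟩, ho⟩ := h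
  have hθ : (g * θ * g⁻¹) • g • C₁ = g • θ • C₁ := by
    rw [mul_smul, inv_smul_smul, mul_smul]
  refine ⟨⟨g • 𝒦, hm.smul g, Set.smul_mem_smul_set m1, Set.smul_mem_smul_set m2,
    Set.smul_mem_smul_set m3, by rw [hθ]; exact Set.smul_mem_smul_set m4, ?_, hs.smul g,
    by rw [Set.ncard_smul_set, hc], ?_⟩, ?_⟩
  · intro 𝒦' N' hm' k1 k2 k3 k4
    rw [hθ] at k4
    rw [← Set.mem_inv_smul_set_iff] at k1 k2 k3 k4
    obtain ⟨h1, h2⟩ := hu _ _ (hm'.smul g⁻¹) k1 k2 k3 k4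
    exact ⟨inv_smul_eq_iff.mp h1, inv_smul_eq_iff.mp h2⟩
  · have h1 := hcyc.conj (g := MulAction.toPermHom (PGammaL K) (Set (Point K)) g)
    have h2 : (MulAction.toPerm (g * θ * g⁻¹) : Equiv.Perm (Set (Point K))) =
        MulAction.toPermHom (PGammaL K) (Set (Point K)) g * MulAction.toPerm θ *
          (MulAction.toPermHom (PGammaL K) (Set (Point K)) g)⁻¹ := by
      rw [← MulAction.toPermHom_apply, map_mul, map_mul, map_inv]; rfl
    rw [h2]
    exact h1
  · have : orderOf (g * θ * g⁻¹) = orderOf θ :=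
      orderOf_injective (MulAut.conj g).toMonoidHom (MulAut.conj g).injective θ
    rw [this]
    exact ho

end Transport

/-! ### The theorem for a Denniston arc in standard position. -/

section Main

variable {K : Type*} [Field K]

theorem conicOf_pencil (α : K) {γ : K} (hγ : γ ≠ 0) :
    conicOf (α * γ, γ, γ) = conic α 1 γ := by
  simp [conicOf, hγ]

variable [Algebra (ZMod 2) K]

/-- The main theorem for a Denniston arc in standard position. -/
theorem generatesSingerArc_of_standard (hK : Nat.card K = 2 ^ 7) {α γ₁ γ₂ : K} (hα : tr α = 1)
    (hγ₁ : γ₁ ≠ 0) (hγ₂ : γ₂ ≠ 0) (hγ₁₂ : γ₁ + γ₂ ≠ 0) (θ : PGammaL K)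
    (h₂₁ : θ • conic α 1 γ₂ = conic α 1 γ₁)
    (hd₁ : Disjoint (θ • conic α 1 γ₁) (conic α 1 γ₁))
    (hd₂ : Disjoint (θ • conic α 1 γ₁) (conic α 1 γ₂))
    (hd₃ : Disjoint (θ • conic α 1 γ₁) (conic α 1 (γ₁ + γ₂)))
    {𝒟 : Set (Set (Point K))} (h𝒟 : 𝒟 = {conic α 1 γ₁, conic α 1 γ₂, conic α 1 (γ₁ + γ₂)})
    (hD : ∃ C, (θ ^ 2 • 𝒟) ∩ 𝒟 = {C}) (hD' : ∃ C, (θ ^ 2 • 𝒟) ∩ (θ • 𝒟) = {C}) :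
    GeneratesSingerArc (conic α 1 γ₁) (conic α 1 γ₂) (conic α 1 (γ₁ + γ₂)) (F₀ K) θ := by
  have : Finite K := Nat.finite_of_card_ne_zero (by rw [hK]; norm_num)
  have := charP_two_of_algebra K
  rw [← conicOf_pencil α hγ₁] at *
  rw [← conicOf_pencil α hγ₂] at *
  rw [← conicOf_pencil α hγ₁₂] at *
  have hF : θ • F₀ K = F₀ K := smul_F₀_of_smul_conicOf (h := (α * γ₂, γ₂, γ₂))
    (h' := (α * γ₁, γ₁, γ₁)) hγ₂ hγ₁ h₂₁
  obtain ⟨σ, hσ⟩ := exists_hasAut θ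
  obtain ⟨M, a, b, hM, hn⟩ := hσ.exists_isNormalForm hF
  have h₁₄ := hn.smul_conicOf hM (h := (α * γ₁, γ₁, γ₁)) hγ₁
  set c := conicAct σ M a b (α * γ₁, γ₁, γ₁) with hc
  have hcγ : c.2.2 ≠ 0 := by
    rw [hc, conicAct_γ]; exact mul_ne_zero (inv_ne_zero hM) (by simpa using hγ₁)
  have hsum : ((α * γ₂, γ₂, γ₂) + (α * γ₁, γ₁, γ₁) : K × K × K) =
      (α * (γ₁ + γ₂), γ₁ + γ₂, γ₁ + γ₂) := by
    ext <;> simp only [Prod.mk_add_mk] <;> ring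
  have htr : ∀ γ : K, γ ≠ 0 → tr (α * γ * γ / γ ^ 2) = 1 := by
    intro γ hγ
    rw [← hα]
    congr 1
    field_simp
  -- The order `C₂`, `C₁`, `C₄` of the generators makes `θ` a shift.
  obtain ⟨ψ, he⟩ := isArcFamily_of_disjoint (c₁ := (α * γ₂, γ₂, γ₂)) (c₂ := (α * γ₁, γ₁, γ₁))
    (c₃ := c) hγ₂ hγ₁ (by rw [hsum]; exact hγ₁₂) hcγ (htr _ hγ₂) (htr _ hγ₁)
    (by rw [hsum]; exact htr _ hγ₁₂) (by rw [← h₁₄]; exact hd₂.symm)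
    (by rw [← h₁₄]; exact hd₁.symm) (by rw [hsum, ← h₁₄]; exact hd₃.symm)
  set e := family (α * γ₂, γ₂, γ₂) (α * γ₁, γ₁, γ₁) c with hedef
  have e1 : e (1, 0, 0) = (α * γ₂, γ₂, γ₂) := by simp [hedef, family_apply]
  have e2 : e (0, 1, 0) = (α * γ₁, γ₁, γ₁) := by simp [hedef, family_apply]
  have e3 : e (0, 0, 1) = c := by simp [hedef, family_apply]
  have e4 : e (1, 1, 0) = (α * (γ₁ + γ₂), γ₁ + γ₂, γ₁ + γ₂) := by
    rw [← hsum]; simp [hedef, family_apply]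
  have hK6 : 6 ≤ Nat.card K := by rw [hK]; norm_num
  have hK8 : 8 ≤ Nat.card K := by rw [hK]; norm_num
  obtain ⟨ε, δ, hcomp⟩ := he.exists_companion hK6 hM hn (by rw [e1, e2]; exact h₂₁)
    (by rw [e2, e3]; exact h₁₄) (by rw [e1, e2, e4]; exact h𝒟) hD hD'
  have hδ := he.companion_parameters hK hM hcomp
  subst hδ
  have hcyc := isCycleOn_conics (e := e) (g := θ) (ε := ε) (fun i hi => by
    rw [hn.smul_conicOf hM (he.ne_zero i hi), hcomp])
  have hncard := he.ncard_conics hK6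
  have m1 : conicOf (α * γ₁, γ₁, γ₁) ∈ conics e := ⟨(0, 1, 0), by decide, by simp only [e2]⟩
  have m2 : conicOf (α * γ₂, γ₂, γ₂) ∈ conics e := ⟨(1, 0, 0), by decide, by simp only [e1]⟩
  have m3 : conicOf (α * (γ₁ + γ₂), γ₁ + γ₂, γ₁ + γ₂) ∈ conics e :=
    ⟨(1, 1, 0), by decide, by simp only [e4]⟩
  have m4 : conicOf c ∈ conics e := ⟨(0, 0, 1), by decide, by simp only [e3]⟩
  refine ⟨⟨conics e, he.isMathonArc hK8, m1, m2, m3, by rw [h₁₄]; exact m4, ?_, ?_, hncard, hcyc⟩,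
    seven_dvd_orderOf hncard hcyc m1 (by rw [pow_orderOf_eq_one, one_smul])⟩
  · intro 𝒦' N' hm k1 k2 _ k4
    rw [h₁₄] at k4
    exact he.eq_of_isMathonArc hK8 hm (by rw [e1]; exact k2) (by rw [e2]; exact k1)
      (by rw [e3]; exact k4)
  · by_cases hDen : IsDennistonArc 8 (conics e) (F₀ K)
    · exact Or.inr ⟨hDen, he.exists_sharplyTransitive hK e1 e2 hcyc⟩
    · refine Or.inl ⟨he.isMathonArc hK8, hDen, he.card_aut hK hα e1 e2 ?_ hF hcyc⟩
      -- If the third generator also lay in the pencil `(αγ, γ, γ)`, so would all sums, and the arc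
      -- would be of Denniston type.
      by_contra hcon
      push Not at hcon
      apply hDen
      set f : Idx →+ K × K × K :=
        { toFun := fun i => (α * (e i).2.2, (e i).2.2, (e i).2.2)
          map_zero' := by simp
          map_add' := fun i j => by
            simp only [map_add, Prod.snd_add, mul_add, Prod.mk_add_mk] } with hf
      have hef : e = f := by
        apply idx_hom_ext
        · simp only [hf, AddMonoidHom.coe_mk, ZeroHom.coe_mk, e1]
        · simp only [hf, AddMonoidHom.coe_mk, ZeroHom.coe_mk, e2]
        · simp only [hf, AddMonoidHom.coe_mk, ZeroHom.coe_mk]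
          ext
          · exact hcon.1
          · exact hcon.2
          · rfl
      exact he.isDennistonArc hK8 hα fun i => DFunLike.congr_fun hef i

end Main

end SingerArc

/-! ### Reduction to standard position by conjugation. -/

theorem mainTheorem4 {K : Type*} [Field K] [Algebra (ZMod 2) K] (hK : Nat.card K = 2 ^ 7)
    (C₁ C₂ C₃ : Set (Point K)) (N : Point K) (hD : IsDennistonArc 4 {C₁, C₂, C₃} N)
    (θ : PGammaL K) (h₂₁ : θ • C₂ = C₁)
    (hd₁ : Disjoint (θ • C₁) C₁) (hd₂ : Disjoint (θ • C₁) C₂) (hd₃ : Disjoint (θ • C₁) C₃)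
    (hN : IsNucleus (θ • C₁) N)
    (hθD : ∃ C, (θ ^ 2 • ({C₁, C₂, C₃} : Set (Set (Point K)))) ∩ {C₁, C₂, C₃} = {C})
    (hθθD : ∃ C, (θ ^ 2 • ({C₁, C₂, C₃} : Set (Set (Point K)))) ∩
      (θ • ({C₁, C₂, C₃} : Set (Set (Point K)))) = {C}) :
    (∃ 𝒦 : Set (Set (Point K)),
      IsMathonArc 8 𝒦 N ∧ C₁ ∈ 𝒦 ∧ C₂ ∈ 𝒦 ∧ C₃ ∈ 𝒦 ∧ θ • C₁ ∈ 𝒦 ∧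
      (∀ (𝒦' : Set (Set (Point K))) (N' : Point K), IsMathonArc 8 𝒦' N' →
        C₁ ∈ 𝒦' → C₂ ∈ 𝒦' → C₃ ∈ 𝒦' → θ • C₁ ∈ 𝒦' → 𝒦' = 𝒦 ∧ N' = N) ∧
      IsSingerArc 𝒦 N ∧
      𝒦.ncard = 7 ∧ (MulAction.toPerm θ : Equiv.Perm (Set (Point K))).IsCycleOn 𝒦) ∧
    7 ∣ orderOf θ := by
  have : Finite K := Nat.finite_of_card_ne_zero (by rw [hK]; norm_num)
  have := charP_two_of_algebra K
  have hK6 : 6 ≤ Nat.card K := by rw [hK]; norm_num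
  obtain ⟨-, α, H, g, hα, hH, h𝒞, rfl⟩ := hD
  have hmem : ∀ C ∈ ({C₁, C₂, C₃} : Set (Set (Point K))), ∃ γ, (γ ∈ H ∧ γ ≠ 0) ∧
      g • conic α 1 γ = C := by
    intro C hC
    rw [h𝒞] at hC
    exact hC
  obtain ⟨γ₁, ⟨hH₁, hγ₁⟩, hC₁⟩ := hmem C₁ (by simp)
  obtain ⟨γ₂, ⟨hH₂, hγ₂⟩, hC₂⟩ := hmem C₂ (by simp)
  have hinj : ∀ γ γ' : K, γ ≠ 0 → γ' ≠ 0 → g • conic α 1 γ = g • conic α 1 γ' → γ = γ' := by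
    intro γ γ' hγ hγ' h
    rw [smul_left_cancel_iff, ← conicOf_pencil α hγ, ← conicOf_pencil α hγ'] at h
    exact congrArg (fun x => x.2.2) (conicOf_injective hK6 hγ hγ' h)
  -- Otherwise `C₁ = C₂`, so `θ` fixes `C₁`, and a nonempty conic would be disjoint from itself.
  have hne : γ₁ + γ₂ ≠ 0 := by
    intro h
    rw [CharTwo.add_eq_zero] at h
    have h12 : C₁ = C₂ := by rw [← hC₁, ← hC₂, h]
    rw [h12] at hd₁ h₂₁
    rw [h₂₁, disjoint_self] at hd₁
    have hnonempty := (conicOf_nonempty (h := (α * γ₂, γ₂, γ₂)) hγ₂).smul_set (a := g)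
    rw [conicOf_pencil α hγ₂, hC₂, hd₁] at hnonempty
    exact Set.not_nonempty_empty hnonempty
  -- Closure of `H` puts the conic of `γ₁ + γ₂` among the three, and it differs from the first two.
  have hC₃ : g • conic α 1 (γ₁ + γ₂) = C₃ := by
    have h3 : g • conic α 1 (γ₁ + γ₂) ∈ ({C₁, C₂, C₃} : Set (Set (Point K))) := by
      rw [h𝒞]
      exact ⟨γ₁ + γ₂, ⟨H.add_mem hH₁ hH₂, hne⟩, rfl⟩
    rcases h3 with h | h | h
    · rw [← hC₁] at h
      exact absurd (hinj _ _ hne hγ₁ h) (by simpa using hγ₂)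
    · rw [← hC₂] at h
      exact absurd (hinj _ _ hne hγ₂ h) (by simpa using hγ₁)
    · exact h
  clear hmem h𝒞
  subst hC₁ hC₂ hC₃
  set θ' := g⁻¹ * θ * g with hθ'
  have hθ : θ = g * θ' * g⁻¹ := by rw [hθ']; group
  have hset : ∀ x y z : Set (Point K), ({g • x, g • y, g • z} : Set (Set (Point K))) =
      g • {x, y, z} := by
    intro x y z
    rw [Set.smul_set_insert, Set.smul_set_insert, Set.smul_set_singleton]
  have hconj : ∀ C : Set (Point K), θ • g • C = g • θ' • C := by
    intro C
    rw [hθ, mul_smul, inv_smul_smul, mul_smul]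
  have hconj' : ∀ 𝒟 : Set (Set (Point K)), θ • g • 𝒟 = g • θ' • 𝒟 := by
    intro 𝒟
    rw [hθ, mul_smul, inv_smul_smul, mul_smul]
  have hconj2 : ∀ 𝒟 : Set (Set (Point K)), θ ^ 2 • g • 𝒟 = g • θ' ^ 2 • 𝒟 := by
    intro 𝒟
    rw [sq, mul_smul, hconj', hconj', ← mul_smul θ', ← sq]
  have hdisj : ∀ X Y : Set (Point K), Disjoint (g • X) (g • Y) → Disjoint X Y := by
    intro X Y h
    rwa [Set.disjoint_iff_inter_eq_empty, ← Set.smul_set_inter, Set.smul_set_eq_empty,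
      ← Set.disjoint_iff_inter_eq_empty] at h
  have hsing : ∀ 𝒟 : Set (Set (Point K)), (∃ C, g • 𝒟 = {C}) → ∃ C, 𝒟 = {C} := by
    rintro 𝒟 ⟨C, hC⟩
    exact ⟨g⁻¹ • C, by rw [← Set.smul_set_singleton, ← hC, inv_smul_smul]⟩
  rw [hconj, smul_left_cancel_iff] at h₂₁
  rw [hconj] at hd₁ hd₂ hd₃
  rw [hset, hconj2, ← Set.smul_set_inter] at hθD
  rw [hset, hconj2, hconj', ← Set.smul_set_inter] at hθθD
  have hmain := (generatesSingerArc_of_standard hK hα hγ₁ hγ₂ hne θ' h₂₁ (hdisj _ _ hd₁)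
    (hdisj _ _ hd₂) (hdisj _ _ hd₃) rfl (hsing _ hθD) (hsing _ hθθD)).smul g
  rw [← hθ] at hmain
  exact hmain
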